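/- Let $\Sigma$ and $\Gamma$ be finite alphabets, let $\mathcal A$ be a (complete) deterministic finite automaton with $s$ states over $\Sigma$ recognising a language $\mathit{Up}\subseteq\Sigma^*$, and let $\tau$ be a partial function $\Sigma^*\to\Gamma^*$ that is implemented by a subsequential transducer and satisfies $\mathrm{dom}(\tau)\subseteq \mathit{Up}$. An observation table $T$ is given by a finite prefix-closed set $P\subseteq\Sigma^*$, a finite suffix-closed set $S\subseteq\Sigma^*$ and a map $T:(P\cup P\Sigma)\cdot S\to\Gamma^*\cup\{\#,\bot\}$ with $T(w)=\#$ if $w\notin\mathit{Up}$, $T(w)=\bot$ if $w\in \mathit{Up}\setminus\mathrm{dom}(\tau)$, and $T(w)=\tau(w)$ otherwise. A subsequential transducer $M=(\Sigma,\Gamma,Q,q_0,w_0,\delta,\delta_F)$ has a finite set $Q$ of states, an initial state $q_0$, an initial production $w_0\in\Gamma^*$, a partial transition function $\delta:Q\times\Sigma\to Q\times\Gamma^*$ and a partial final function $\delta_F:Q\to\Gamma^*$; it implements the partial function $[\![M]\!]$ that maps $u$ to $w_0\cdot w\cdot\delta_F(q)$ when reading $u$ from $q_0$ leads to $q$ with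 output $w$ and $\delta_F(q)$ is defined. Transducers are assumed trim: every state is reachable from $q_0$, and from every state other than possibly $q_0$ a final state is reachable. $M$ is compatible with $T$ if, for every $w\in(P\cup P\Sigma)\cdot S$, $[\![M]\!](w)=T(w)$ whenever $T(w)\in\Gamma^*$, and $w\notin\mathrm{dom}[\![M]\!]$ whenever $T(w)=\bot$. A minimal transducer for $T$ is a trim transducer compatible with $T$ with the least possible number of states. Proposition. The subroutines $\mathrm{MinGen}$ and $\mathrm{CompetingMinGen}$ can be effectively implemented. That is, there are two algorithms (total computable functions), each taking as input the sizes of $\Sigma$ and $\Gamma$, the automaton $\mathcal A$ and the table $T$ (but not $\tau$), with the following properties for all $\Sigma,\Gamma,\mathcal A,\tau,T$ as above. 1. $\mathrm{MinGen}(T)$ returns a minimal transducer for $T$ (in particular, one exists). 2. If there are two minimal transducers for $T$ whose partial functions differ on some word of $\mathit{Up}$, then $\mathrm{CompetingMinGen}(T)$ returns two minimal transducers $M_1,M_2$ for $T$ and a word $u\in\mathit{Up}$ on which $[\![M_1]\!]$ and $[\![M_2]\!]$ differ (one of them being undefined at $u$ counts as a difference when the other is defined), with $|u|\le 2\,(n\cdot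 n\cdot s)^2$, where $n$ is the number of states of a minimal transducer for $T$. 3. If all minimal transducers for $T$ agree on $\mathit{Up}$, then $\mathrm{CompetingMinGen}(T)$ returns $\emptyset$. -/

import Mathlib

/-! Words over an alphabet with `k` letters are lists over `Fin k`. -/

/-- A subsequential string transducer with input alphabet `Fin k`, output alphabet `Fin m` and
set of states `Fin n`: an initial state, an initial production, a partial transition function and
a partial final function. -/
structure Transducer (k m n : ℕ) where
  init : Fin n
  initOut : List (Fin m)
  step : Fin n → Fin k → Option (Fin n × List (Fin m))
  final : Fin n → Option (List (Fin m))

namespace Transducer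

variable {k m n : ℕ}

/-- `M.run q u = some (q', w)` iff reading `u` from `q` leads to `q'` and produces `w`. -/
def run (M : Transducer k m n) : Fin n → List (Fin k) → Option (Fin n × List (Fin m))
  | q, [] => some (q, [])
  | q, a :: u =>
    (M.step q a).bind fun x => (M.run x.1 u).map fun y => (y.1, x.2 ++ y.2)

/-- The partial function computed from the state `q`. -/
def semFrom (M : Transducer k m n) (q : Fin n) (u : List (Fin k)) : Option (List (Fin m)) :=
  (M.run q u).bind fun x => (M.final x.1).map fun w => x.2 ++ w

/-- The partial function implemented by `M` (`none` means undefined). -/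
def sem (M : Transducer k m n) (u : List (Fin k)) : Option (List (Fin m)) :=
  (M.semFrom M.init u).map fun w => M.initOut ++ w

/-- Trim: every state is reachable from the initial state, and a final state can be reached from
every state. The initial state is exempt from the second condition, which only makes a difference
for the one-state transducers with empty domain. -/
def IsTrim (M : Transducer k m n) : Prop :=
  (∀ q, ∃ u w, M.run M.init u = some (q, w)) ∧
    ∀ q, q ≠ M.init → ∃ u w, M.semFrom q u = some w

end Transducer

/-- The possible entries of an observation table over the output alphabet `Fin m`. -/
inductive TableEntry (m : ℕ) where
  /-- the entry `#`: the word is outside the upper bound -/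
  | hash : TableEntry m
  /-- the entry `⊥`: the word is in the upper bound but not in the domain of the target -/
  | bot : TableEntry m
  /-- an output word -/
  | out : List (Fin m) → TableEntry m

/-- The words of `P ∪ P · Σ`, as a list. -/
def tableRows {k : ℕ} (P : List (List (Fin k))) : List (List (Fin k)) :=
  P ++ P.flatMap fun u => (List.finRange k).map fun a => u ++ [a]

/-- An observation table for the target `τ` and the domain upper bound recognised by `A`. The
finite sets `P` and `S` are presented as lists. Only the values of `entry` on the words of
`(P ∪ P · Σ) · S` are meaningful, and only those are ever used. -/
structure ObservationTable {k m s : ℕ} (A : DFA (Fin k) (Fin s))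
    (τ : List (Fin k) → Option (List (Fin m))) where
  P : List (List (Fin k))
  S : List (List (Fin k))
  prefix_closed : ∀ u ∈ P, ∀ v, v <+: u → v ∈ P
  suffix_closed : ∀ u ∈ S, ∀ v, v <:+ u → v ∈ S
  entry : List (Fin k) → TableEntry m
  entry_hash : ∀ u ∈ tableRows P, ∀ v ∈ S, u ++ v ∉ A.accepts → entry (u ++ v) = .hash
  entry_bot : ∀ u ∈ tableRows P, ∀ v ∈ S, u ++ v ∈ A.accepts → τ (u ++ v) = none →
    entry (u ++ v) = .bot
  entry_out : ∀ u ∈ tableRows P, ∀ v ∈ S, u ++ v ∈ A.accepts → ∀ w, τ (u ++ v) = some w →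
    entry (u ++ v) = .out w

namespace Transducer

variable {k m n s : ℕ} {A : DFA (Fin k) (Fin s)} {τ : List (Fin k) → Option (List (Fin m))}

/-- `M` is compatible with the table `T`. -/
def IsCompatible (M : Transducer k m n) (T : ObservationTable A τ) : Prop :=
  ∀ u ∈ tableRows T.P, ∀ v ∈ T.S,
    (∀ w, T.entry (u ++ v) = .out w → M.sem (u ++ v) = some w) ∧
      (T.entry (u ++ v) = .bot → M.sem (u ++ v) = none)

/-- `M` is a minimal transducer compatible with `T`: it is trim and compatible, and no trim
transducer compatible with `T` has fewer states. -/
def IsMinimalCompatible (M : Transducer k m n) (T : ObservationTable A τ) : Prop :=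
  M.IsTrim ∧ M.IsCompatible T ∧
    ∀ (n' : ℕ) (M' : Transducer k m n'), M'.IsTrim → M'.IsCompatible T → n ≤ n'

end Transducer

/-! The input and output of algorithms: explicit finite presentations built from natural numbers,
Booleans, pairs, options and lists. Letters and states are represented by their numbers. -/

/-- The word with its letters read as natural numbers. -/
def wordCode {k : ℕ} (u : List (Fin k)) : List ℕ :=
  u.map fun a => (a : ℕ)

/-- Initial state, initial production, and for every state the row of its transitions and its
final output. -/
abbrev TransducerCode : Type :=
  ℕ × List ℕ × List (List (Option (ℕ × List ℕ)) × Option (List ℕ))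

def Transducer.code {k m n : ℕ} (M : Transducer k m n) : TransducerCode :=
  (M.init, wordCode M.initOut, List.ofFn fun q =>
    (List.ofFn fun a => (M.step q a).map fun x => ((x.1 : ℕ), wordCode x.2),
      (M.final q).map wordCode))

/-- Initial state, and for every state the row of its successors and whether it is accepting. -/
abbrev DFACode : Type :=
  ℕ × List (List ℕ × Bool)

open Classical in
noncomputable def dfaCode {k s : ℕ} (A : DFA (Fin k) (Fin s)) : DFACode :=
  (A.start, List.ofFn fun q =>
    (List.ofFn fun a => (A.step q a : ℕ), decide (q ∈ A.accept)))

def TableEntry.code {m : ℕ} : TableEntry m → Option (Option (List ℕ))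
  | .hash => none
  | .bot => some none
  | .out w => some (some (wordCode w))

/-- The lists `P` and `S`, and the matrix of the entries, with rows indexed by `P ∪ P · Σ` and
columns indexed by `S`. -/
abbrev TableCode : Type :=
  List (List ℕ) × List (List ℕ) × List (List (Option (Option (List ℕ))))

/-- The sizes of the two alphabets, the automaton for the upper bound, and the table. -/
abbrev InputCode : Type :=
  (ℕ × ℕ) × DFACode × TableCode

namespace ObservationTable

variable {k m s : ℕ} {A : DFA (Fin k) (Fin s)} {τ : List (Fin k) → Option (List (Fin m))}

def code (T : ObservationTable A τ) : TableCode :=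
  (T.P.map wordCode, T.S.map wordCode,
    (tableRows T.P).map fun u => T.S.map fun v => (T.entry (u ++ v)).code)

/-- What the algorithms are given: the alphabets, the automaton of the upper bound and the table,
but not the target `τ`. -/
noncomputable def inputCode (T : ObservationTable A τ) : InputCode :=
  ((k, m), dfaCode A, T.code)

/-- `M₁` and `M₂` are minimal transducers compatible with `T`, and the word `u` of the upper bound
tells them apart. -/
def IsCompeting (T : ObservationTable A τ) {n₁ n₂ : ℕ} (M₁ : Transducer k m n₁)
    (M₂ : Transducer k m n₂) (u : List (Fin k)) : Prop :=
  M₁.IsMinimalCompatible T ∧ M₂.IsMinimalCompatible T ∧ u ∈ A.accepts ∧ M₁.sem u ≠ M₂.sem u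

end ObservationTable

/-! ### Primitive recursive list operations -/

section PrimrecLists

variable {α β γ : Type*} [Primcodable α] [Primcodable β] [Primcodable γ]

/-! Both algorithms are exhaustive searches, so everything rests on bounding what has to be
searched: the number of states, the length of the productions, and the length of the separating
word. With these bounds, all objects involved are explicit finite lists and the searches are
primitive recursive.

States: the prefix tree of the table words that carry an output is a trim compatible transducer
(`exists_trim_transducer_of_list`), so a minimal one exists and is no larger than this tree.

Productions: let `c` bound the outputs in the table. Cutting every production to length `c` keeps
states, moves and domain, and cannot affect an output of length at most `c`; hence it preserves
minimality. It may, however, destroy the difference between two minimal transducers at a word `v`.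
In that case it has changed the value of one of them, `M`, at `v`, so some production longer than
`c` is used there. Cutting `M` at `c` and at `c + 1` then gives outputs of different lengths at `v`,
that is, a competing pair within the bound `c + 1` (`exists_isCompeting_outputsLE`).

Separating word: put `N = n₁ * n₂ * s`, the number of joint states of two transducers and the
automaton. A difference on the upper bound already shows at a word shorter than `2 * N`
(`exists_short_difference`). Differences of domain are shortened by removing loops. For differences
of output, removing a loop may change the outputs, so one uses instead that the delay between the
two runs at a joint state with a common completion is determined by short words alone
(`append_eq_append_of_common_completion`). Finally `2 * N ≤ 2 * N ^ 2`.

Conversely, every answer of the search decodes to an actual competing pair, so the search comes out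
empty when there is none. -/

theorem Primrec.list_filter_param {f : α → List β} {p : α → β → Bool} (hf : Primrec f)
    (hp : Primrec₂ p) : Primrec fun a => (f a).filter (p a) :=
  (Primrec.listFilterMap (g := fun a b => bif p a b then some b else none) hf
    (Primrec.cond hp (Primrec.option_some.comp Primrec.snd) (Primrec.const none)).to₂).of_eq
    fun a => by
      induction f a with
      | nil => rfl
      | cons b l ih => cases h : p a b <;> simp [h, ih]

theorem Primrec.list_all {f : α → List β} {p : α → β → Bool} (hf : Primrec f)
    (hp : Primrec₂ p) : Primrec fun a => (f a).all (p a) :=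
  (Primrec.list_foldr (h := fun a x => p a x.1 && x.2) hf (Primrec.const true)
    (Primrec.and.comp (hp.comp Primrec.fst (Primrec.fst.comp Primrec.snd))
      (Primrec.snd.comp Primrec.snd)).to₂).of_eq fun a => by
    induction f a <;> simp_all

theorem Primrec.list_any {f : α → List β} {p : α → β → Bool} (hf : Primrec f)
    (hp : Primrec₂ p) : Primrec fun a => (f a).any (p a) :=
  (Primrec.list_foldr (h := fun a x => p a x.1 || x.2) hf (Primrec.const false)
    (Primrec.or.comp (hp.comp Primrec.fst (Primrec.fst.comp Primrec.snd))
      (Primrec.snd.comp Primrec.snd)).to₂).of_eq fun a => by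
    induction f a <;> simp_all

theorem Primrec.list_sum_map {f : α → List β} {g : α → β → ℕ} (hf : Primrec f)
    (hg : Primrec₂ g) : Primrec fun a => ((f a).map (g a)).sum :=
  (Primrec.list_foldr (h := fun a x => g a x.1 + x.2) hf (Primrec.const 0)
    (Primrec.nat_add.comp (hg.comp Primrec.fst (Primrec.fst.comp Primrec.snd))
      (Primrec.snd.comp Primrec.snd)).to₂).of_eq fun a => by
    induction f a <;> simp_all

theorem Primrec.list_product {f : α → List β} {g : α → List γ} (hf : Primrec f)
    (hg : Primrec g) : Primrec fun a => (f a).product (g a) :=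
  Primrec.list_flatMap hf
    (Primrec.list_map (hg.comp Primrec.fst)
      (Primrec.pair (Primrec.snd.comp Primrec.fst) Primrec.snd).to₂).to₂

/-- All lists of length `n` with entries in `l`. -/
def tuples {α : Type*} (l : List α) (n : ℕ) : List (List α) :=
  Nat.rec [[]] (fun _ acc => acc.flatMap fun t => l.map fun x => x :: t) n

theorem Primrec.tuples {f : α → List β} {g : α → ℕ} (hf : Primrec f) (hg : Primrec g) :
    Primrec fun a => tuples (f a) (g a) :=
  (Primrec.nat_rec' (h := fun a x => x.2.flatMap fun t => (f a).map fun y => y :: t)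
    hg (Primrec.const [[]])
    (Primrec.list_flatMap (Primrec.snd.comp Primrec.snd)
      (Primrec.list_map (hf.comp (Primrec.fst.comp Primrec.fst))
        (Primrec.list_cons.comp Primrec.snd (Primrec.snd.comp Primrec.fst)).to₂).to₂).to₂).of_eq
    fun _ => rfl

theorem mem_tuples {α : Type*} {l : List α} {n : ℕ} {x : List α} :
    x ∈ tuples l n ↔ x.length = n ∧ ∀ a ∈ x, a ∈ l := by
  induction n generalizing x with
  | zero => cases x <;> simp [tuples]
  | succ n ih =>
    have : tuples l (n + 1) = (tuples l n).flatMap fun t => l.map fun y => y :: t := rfl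
    rw [this]
    cases x with
    | nil => simp
    | cons a x => simp [ih]; tauto

/-- The partial elements over `l`. -/
def optionsOf {α : Type*} (l : List α) : List (Option α) :=
  none :: l.map some

theorem Primrec.optionsOf {f : α → List β} (hf : Primrec f) :
    Primrec fun a => optionsOf (f a) :=
  Primrec.list_cons.comp (Primrec.const none)
    (Primrec.list_map hf (Primrec.option_some.comp Primrec.snd).to₂)

/-- The pairs of entries of two lists at the same position. -/
def pairUp {α β : Type*} (l : List α) (l' : List β) : List (α × β) :=
  (List.range l.length).filterMap fun i => (l[i]?).bind fun a => (l'[i]?).map fun b => (a, b)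

theorem Primrec.pairUp {f : α → List β} {g : α → List γ} (hf : Primrec f) (hg : Primrec g) :
    Primrec fun a => pairUp (f a) (g a) :=
  Primrec.listFilterMap (Primrec.list_range.comp (Primrec.list_length.comp hf))
    (Primrec.option_bind (Primrec.list_getElem?.comp (hf.comp Primrec.fst) Primrec.snd)
      (Primrec.option_map (Primrec.list_getElem?.comp (hg.comp (Primrec.fst.comp Primrec.fst))
        (Primrec.snd.comp Primrec.fst))
        (Primrec.pair (Primrec.snd.comp Primrec.fst) Primrec.snd).to₂).to₂).to₂

theorem pairUp_map {ι α β : Type*} (l : List ι) (f : ι → α) (g : ι → β) :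
    pairUp (l.map f) (l.map g) = l.map fun i => (f i, g i) := by
  have h : (List.range l.length).map (fun i => l[i]?) = l.map some := by
    apply List.ext_getElem <;> simp
  have h' : (List.range l.length).filterMap (fun i => l[i]?) = l := by
    simpa [List.filterMap_map, Function.comp_def] using congrArg (List.filterMap id) h
  conv_rhs => rw [← h', List.map_filterMap]
  simp only [pairUp, List.length_map, List.getElem?_map]
  refine List.filterMap_congr fun i _ => ?_
  cases l[i]? <;> rfl

end PrimrecLists

/-! ### The algorithms, on codes -/

/-- The words of length at most `L` over `k` letters. -/
def wordsUpTo (k L : ℕ) : List (List ℕ) :=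
  (List.range (L + 1)).flatMap fun i => tuples (List.range k) i

/-- The codes of the transducers with `n` states whose transitions, initial production and final
outputs have length at most `b`. -/
def transducerCodes (k m n b : ℕ) : List TransducerCode :=
  (List.range n).product ((wordsUpTo m b).product
    (tuples ((tuples (optionsOf ((List.range n).product (wordsUpTo m b))) k).product
      (optionsOf (wordsUpTo m b))) n))

/-- Read a word, starting with a state and an output produced so far. -/
def runCode (M : TransducerCode) (x : ℕ × List ℕ) (u : List ℕ) : Option (ℕ × List ℕ) :=
  u.foldl (fun o a => o.bind fun x => (M.2.2[x.1]?).bind fun r => (r.1[a]?).bind fun t =>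
    t.map fun y => (y.1, x.2 ++ y.2)) (some x)

/-- Read a word and append the final output. -/
def evalCode (M : TransducerCode) (x : ℕ × List ℕ) (u : List ℕ) : Option (List ℕ) :=
  (runCode M x u).bind fun y => (M.2.2[y.1]?).bind fun r => r.2.map fun w => y.2 ++ w

def semCode (M : TransducerCode) (u : List ℕ) : Option (List ℕ) :=
  evalCode M (M.1, M.2.1) u

/-- The defaults `0` and `false` are never used when `D` is the code of an automaton and `u` that of
a word over its alphabet. -/
def acceptsCode (D : DFACode) (u : List ℕ) : Bool :=
  ((D.2[u.foldl (fun q a => ((D.2[q]?).bind fun r => r.1[a]?).getD 0) D.1]?).map Prod.snd).getD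
    false

def rowsCode (k : ℕ) (P : List (List ℕ)) : List (List ℕ) :=
  P ++ P.flatMap fun u => (List.range k).map fun a => u ++ [a]

/-- The words of the table with their entries. -/
def tableWords (I : InputCode) : List (List ℕ × Option (Option (List ℕ))) :=
  (pairUp (rowsCode I.1.1 I.2.2.1) I.2.2.2.2).flatMap fun x =>
    (pairUp I.2.2.2.1 x.2).map fun y => (x.1 ++ y.1, y.2)

/-- An entry `none` stands for `#` and imposes nothing. The codes of `⊥` and of an output are `some`
of the value that the transducer must take, so one equation covers both. -/
def compatibleCode (I : InputCode) (M : TransducerCode) : Bool :=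
  (tableWords I).all fun x => decide (x.2 = none) || decide (x.2 = some (semCode M x.1))

def trimCode (k : ℕ) (M : TransducerCode) : Bool :=
  (List.range M.2.2.length).all fun q =>
    ((wordsUpTo k M.2.2.length).any fun u => decide ((runCode M (M.1, []) u).map Prod.fst = some q)) &&
      (decide (q = M.1) || (wordsUpTo k M.2.2.length).any fun u => (evalCode M (q, []) u).isSome)

/-- A bound for the length of the outputs in the table. -/
def outputBound (I : InputCode) : ℕ :=
  ((tableWords I).map fun x => ((x.2.bind id).map List.length).getD 0).sum

/-- A bound for the number of prefixes of the words of the table. -/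
def stateBound (I : InputCode) : ℕ :=
  ((tableWords I).map fun x => x.1.length + 1).sum + 1

/-- The trim compatible transducers within the bounds. -/
def goodCodes (I : InputCode) : List TransducerCode :=
  (List.range (stateBound I + 1)).flatMap fun n =>
    -- Productions of length `outputBound I` are enough to realise the minimal number of states; the
    -- additional letter is needed for competing pairs.
    (transducerCodes I.1.1 I.1.2 n (outputBound I + 1)).filter fun M =>
      compatibleCode I M && trimCode I.1.1 M

def minimalCodes (I : InputCode) : List TransducerCode :=
  (goodCodes I).filter fun M =>
    (goodCodes I).all fun M' => decide (M.2.2.length ≤ M'.2.2.length)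

/-- The default of `headI` plays no role for the code of a table, where `minimalCodes I` is
nonempty. -/
def minGenCode (I : InputCode) : TransducerCode :=
  (minimalCodes I).headI

/-- The bound for the length of the words that are tried on the minimal transducers. -/
def testLength (I : InputCode) : ℕ :=
  2 * ((minGenCode I).2.2.length * (minGenCode I).2.2.length * I.2.1.2.length) ^ 2

def competingCode (I : InputCode) : Option (TransducerCode × TransducerCode × List ℕ) :=
  (((minimalCodes I).product ((minimalCodes I).product
    (wordsUpTo I.1.1 (testLength I)))).filter fun t =>
      acceptsCode I.2.1 t.2.2 && !decide (semCode t.1 t.2.2 = semCode t.2.1 t.2.2)).head?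

/-! ### Primitive recursiveness of the algorithms -/

section PrimrecAlgorithms

variable {α : Type*} [Primcodable α]

theorem Primrec.wordsUpTo {f g : α → ℕ} (hf : Primrec f) (hg : Primrec g) :
    Primrec fun a => wordsUpTo (f a) (g a) :=
  Primrec.list_flatMap (Primrec.list_range.comp (Primrec.succ.comp hg))
    (Primrec.tuples (Primrec.list_range.comp (hf.comp Primrec.fst)) Primrec.snd).to₂

theorem Primrec.transducerCodes {k m n b : α → ℕ} (hk : Primrec k) (hm : Primrec m)
    (hn : Primrec n) (hb : Primrec b) :
    Primrec fun a => transducerCodes (k a) (m a) (n a) (b a) := by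
  have hr := Primrec.list_range.comp hn
  have hw := Primrec.wordsUpTo hm hb
  exact Primrec.list_product hr (Primrec.list_product hw (Primrec.tuples (Primrec.list_product
    (Primrec.tuples (Primrec.optionsOf (Primrec.list_product hr hw)) hk)
    (Primrec.optionsOf hw)) hn))

theorem Primrec.runCode {M : α → TransducerCode} {x : α → ℕ × List ℕ} {u : α → List ℕ}
    (hM : Primrec M) (hx : Primrec x) (hu : Primrec u) :
    Primrec fun a => runCode (M a) (x a) (u a) := by
  have hrows : Primrec fun a => (M a).2.2 := Primrec.snd.comp (Primrec.snd.comp hM)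
  refine Primrec.list_foldl (h := fun a s => s.1.bind fun x => ((M a).2.2[x.1]?).bind fun r =>
    (r.1[s.2]?).bind fun t => t.map fun y => (y.1, x.2 ++ y.2)) hu
    (Primrec.option_some.comp hx) (Primrec₂.mk ?_)
  refine Primrec.option_bind (Primrec.fst.comp Primrec.snd) (Primrec₂.mk ?_)
  refine Primrec.option_bind (Primrec.list_getElem?.comp
    (hrows.comp (Primrec.fst.comp Primrec.fst)) (Primrec.fst.comp Primrec.snd)) (Primrec₂.mk ?_)
  refine Primrec.option_bind (Primrec.list_getElem?.comp (Primrec.fst.comp Primrec.snd)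
    (Primrec.snd.comp (Primrec.snd.comp (Primrec.fst.comp Primrec.fst)))) (Primrec₂.mk ?_)
  refine Primrec.option_map Primrec.snd (Primrec₂.mk ?_)
  exact Primrec.pair (Primrec.fst.comp Primrec.snd) (Primrec.list_append.comp
    (Primrec.snd.comp (Primrec.snd.comp (Primrec.fst.comp (Primrec.fst.comp Primrec.fst))))
    (Primrec.snd.comp Primrec.snd))

theorem Primrec.evalCode {M : α → TransducerCode} {x : α → ℕ × List ℕ} {u : α → List ℕ}
    (hM : Primrec M) (hx : Primrec x) (hu : Primrec u) :
    Primrec fun a => evalCode (M a) (x a) (u a) := by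
  have hrows : Primrec fun a => (M a).2.2 := Primrec.snd.comp (Primrec.snd.comp hM)
  refine Primrec.option_bind (Primrec.runCode hM hx hu) (Primrec₂.mk ?_)
  refine Primrec.option_bind (Primrec.list_getElem?.comp (hrows.comp Primrec.fst)
    (Primrec.fst.comp Primrec.snd)) (Primrec₂.mk ?_)
  refine Primrec.option_map (Primrec.snd.comp Primrec.snd) (Primrec₂.mk ?_)
  exact Primrec.list_append.comp
    (Primrec.snd.comp (Primrec.snd.comp (Primrec.fst.comp Primrec.fst))) Primrec.snd

theorem Primrec.semCode {M : α → TransducerCode} {u : α → List ℕ} (hM : Primrec M)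
    (hu : Primrec u) : Primrec fun a => semCode (M a) (u a) :=
  Primrec.evalCode hM (Primrec.pair (Primrec.fst.comp hM)
    (Primrec.fst.comp (Primrec.snd.comp hM))) hu

theorem Primrec.acceptsCode {D : α → DFACode} {u : α → List ℕ} (hD : Primrec D)
    (hu : Primrec u) : Primrec fun a => acceptsCode (D a) (u a) := by
  have hrows : Primrec fun a => (D a).2 := Primrec.snd.comp hD
  refine Primrec.option_getD.comp (Primrec.option_map (Primrec.list_getElem?.comp hrows ?_)
    (Primrec.snd.comp Primrec.snd).to₂) (Primrec.const false)
  refine Primrec.list_foldl (h := fun a s => (((D a).2[s.1]?).bind fun r => r.1[s.2]?).getD 0) hu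
    (Primrec.fst.comp hD) (Primrec₂.mk ?_)
  refine Primrec.option_getD.comp (Primrec.option_bind (Primrec.list_getElem?.comp
    (hrows.comp Primrec.fst) (Primrec.fst.comp Primrec.snd)) (Primrec₂.mk ?_)) (Primrec.const 0)
  exact Primrec.list_getElem?.comp (Primrec.fst.comp Primrec.snd)
    (Primrec.snd.comp (Primrec.snd.comp Primrec.fst))

theorem Primrec.rowsCode {k : α → ℕ} {P : α → List (List ℕ)} (hk : Primrec k)
    (hP : Primrec P) : Primrec fun a => rowsCode (k a) (P a) :=
  Primrec.list_append.comp hP (Primrec.list_flatMap hP (Primrec.list_map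
    (Primrec.list_range.comp (hk.comp Primrec.fst)) (Primrec.list_concat.comp
      (Primrec.snd.comp Primrec.fst) Primrec.snd).to₂).to₂)

theorem primrec_tableWords : Primrec tableWords := by
  have hT : Primrec fun I : InputCode => I.2.2 := Primrec.snd.comp Primrec.snd
  have hP : Primrec fun I : InputCode => I.2.2.1 := Primrec.fst.comp hT
  have hS : Primrec fun I : InputCode => I.2.2.2.1 := Primrec.fst.comp (Primrec.snd.comp hT)
  have hE : Primrec fun I : InputCode => I.2.2.2.2 := Primrec.snd.comp (Primrec.snd.comp hT)
  have hk : Primrec fun I : InputCode => I.1.1 := Primrec.fst.comp Primrec.fst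
  have h₁ : Primrec₂ fun (x : List ℕ × List (Option (Option (List ℕ))))
      (y : List ℕ × Option (Option (List ℕ))) => (x.1 ++ y.1, y.2) :=
    Primrec.pair (Primrec.list_append.comp (Primrec.fst.comp Primrec.fst)
      (Primrec.fst.comp Primrec.snd)) (Primrec.snd.comp Primrec.snd)
  have h₂ : Primrec₂ fun (S : List (List ℕ)) (x : List ℕ × List (Option (Option (List ℕ)))) =>
      (pairUp S x.2).map fun y => (x.1 ++ y.1, y.2) :=
    Primrec.list_map (Primrec.pairUp Primrec.fst (Primrec.snd.comp Primrec.snd))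
      (h₁.comp (Primrec.snd.comp Primrec.fst) Primrec.snd).to₂
  exact Primrec.list_flatMap (Primrec.pairUp (Primrec.rowsCode hk hP) hE)
    (h₂.comp (hS.comp Primrec.fst) Primrec.snd).to₂

theorem Primrec.compatibleCode {I : α → InputCode} {M : α → TransducerCode} (hI : Primrec I)
    (hM : Primrec M) : Primrec fun a => compatibleCode (I a) (M a) :=
  Primrec.list_all (primrec_tableWords.comp hI) (Primrec.or.comp
    (Primrec.eq.decide.comp (Primrec.snd.comp Primrec.snd) (Primrec.const none))
    (Primrec.eq.decide.comp (Primrec.snd.comp Primrec.snd) (Primrec.option_some.comp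
      (Primrec.semCode (hM.comp Primrec.fst) (Primrec.fst.comp Primrec.snd))))).to₂

theorem Primrec.trimCode {k : α → ℕ} {M : α → TransducerCode} (hk : Primrec k)
    (hM : Primrec M) : Primrec fun a => trimCode (k a) (M a) := by
  have hn : Primrec fun a => (M a).2.2.length :=
    Primrec.list_length.comp (Primrec.snd.comp (Primrec.snd.comp hM))
  have hw : Primrec fun x : α × ℕ => _root_.wordsUpTo (k x.1) (M x.1).2.2.length :=
    (Primrec.wordsUpTo hk hn).comp Primrec.fst
  have hM' : Primrec fun x : (α × ℕ) × List ℕ => M x.1.1 :=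
    hM.comp (Primrec.fst.comp Primrec.fst)
  refine Primrec.list_all (Primrec.list_range.comp hn) (Primrec₂.mk ?_)
  refine Primrec.and.comp (Primrec.list_any hw (Primrec₂.mk ?_))
    (Primrec.or.comp (Primrec.eq.decide.comp Primrec.snd (Primrec.fst.comp (hM.comp Primrec.fst)))
      (Primrec.list_any hw (Primrec₂.mk ?_)))
  · exact Primrec.eq.decide.comp (Primrec.option_map (Primrec.runCode hM'
      (Primrec.pair (Primrec.fst.comp hM') (Primrec.const [])) Primrec.snd)
      (Primrec.fst.comp Primrec.snd).to₂)
      (Primrec.option_some.comp (Primrec.snd.comp Primrec.fst))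
  · exact Primrec.option_isSome.comp (Primrec.evalCode hM'
      (Primrec.pair (Primrec.snd.comp Primrec.fst) (Primrec.const [])) Primrec.snd)

theorem primrec_outputBound : Primrec outputBound :=
  Primrec.list_sum_map primrec_tableWords (Primrec.option_getD.comp (Primrec.option_map
    (Primrec.option_bind (Primrec.snd.comp Primrec.snd) Primrec.snd.to₂)
    (Primrec.list_length.comp Primrec.snd).to₂) (Primrec.const 0)).to₂

theorem primrec_stateBound : Primrec stateBound :=
  Primrec.succ.comp (Primrec.list_sum_map primrec_tableWords (Primrec.succ.comp
    (Primrec.list_length.comp (Primrec.fst.comp Primrec.snd))).to₂)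

theorem primrec_goodCodes : Primrec goodCodes := by
  have hk : Primrec fun I : InputCode => I.1.1 := Primrec.fst.comp Primrec.fst
  have hm : Primrec fun I : InputCode => I.1.2 := Primrec.snd.comp Primrec.fst
  have h₁ : Primrec₂ fun (I : InputCode) (n : ℕ) =>
      transducerCodes I.1.1 I.1.2 n (outputBound I + 1) :=
    Primrec.transducerCodes (hk.comp Primrec.fst) (hm.comp Primrec.fst) Primrec.snd
      (Primrec.succ.comp (primrec_outputBound.comp Primrec.fst))
  have h₂ : Primrec₂ fun (I : InputCode) (M : TransducerCode) =>
      compatibleCode I M && trimCode I.1.1 M :=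
    Primrec.and.comp (Primrec.compatibleCode Primrec.fst Primrec.snd)
      (Primrec.trimCode (hk.comp Primrec.fst) Primrec.snd)
  have h₃ : Primrec₂ fun (I : InputCode) (n : ℕ) =>
      (transducerCodes I.1.1 I.1.2 n (outputBound I + 1)).filter fun M =>
        compatibleCode I M && trimCode I.1.1 M :=
    Primrec.list_filter_param h₁ (h₂.comp (Primrec.fst.comp Primrec.fst) Primrec.snd).to₂
  exact Primrec.list_flatMap (Primrec.list_range.comp (Primrec.succ.comp primrec_stateBound)) h₃

theorem primrec_length_rows : Primrec fun M : TransducerCode => M.2.2.length :=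
  Primrec.list_length.comp (Primrec.snd.comp Primrec.snd)

theorem primrec_minimalCodes : Primrec minimalCodes :=
  Primrec.list_filter_param primrec_goodCodes (Primrec.list_all
    (primrec_goodCodes.comp Primrec.fst) (Primrec.nat_le.decide.comp
      (primrec_length_rows.comp (Primrec.snd.comp Primrec.fst))
      (primrec_length_rows.comp Primrec.snd)).to₂).to₂

theorem primrec_minGenCode : Primrec minGenCode :=
  Primrec.list_headI.comp primrec_minimalCodes

theorem primrec_testLength : Primrec testLength := by
  have hn := primrec_length_rows.comp primrec_minGenCode
  have hN := Primrec.nat_mul.comp (Primrec.nat_mul.comp hn hn) (Primrec.list_length.comp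
    (Primrec.snd.comp (Primrec.fst.comp (Primrec.snd (α := ℕ × ℕ) (β := DFACode × TableCode)))))
  exact (Primrec.nat_mul.comp (Primrec.const 2) (Primrec.nat_mul.comp hN hN)).of_eq fun I => by
    rw [testLength, sq]

theorem primrec_competingCode : Primrec competingCode := by
  have hk : Primrec fun I : InputCode => I.1.1 := Primrec.fst.comp Primrec.fst
  have hD : Primrec fun I : InputCode => I.2.1 := Primrec.fst.comp Primrec.snd
  have hu : Primrec fun t : TransducerCode × TransducerCode × List ℕ => t.2.2 :=
    Primrec.snd.comp Primrec.snd
  have h₁ : Primrec fun t : TransducerCode × TransducerCode × List ℕ =>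
      !decide (semCode t.1 t.2.2 = semCode t.2.1 t.2.2) :=
    Primrec.not.comp (Primrec.eq.decide.comp (Primrec.semCode Primrec.fst hu)
      (Primrec.semCode (Primrec.fst.comp Primrec.snd) hu))
  have h₂ : Primrec₂ fun (I : InputCode) (t : TransducerCode × TransducerCode × List ℕ) =>
      acceptsCode I.2.1 t.2.2 && !decide (semCode t.1 t.2.2 = semCode t.2.1 t.2.2) :=
    Primrec.and.comp (Primrec.acceptsCode (hD.comp Primrec.fst) (hu.comp Primrec.snd))
      (h₁.comp Primrec.snd)
  have h₃ := Primrec.wordsUpTo hk primrec_testLength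
  exact Primrec.list_head?.comp (Primrec.list_filter_param (Primrec.list_product
    primrec_minimalCodes (Primrec.list_product primrec_minimalCodes h₃)) h₂)

end PrimrecAlgorithms

/-! ### Short paths in finite deterministic systems -/

section ShortPaths

variable {α β σ : Type*}

/-- Loop removal: a path with at least as many letters as there are states visits some state twice,
and the factor between the two visits can be deleted. -/
theorem exists_foldlM_length_lt_card [Fintype α] (f : α → σ → Option α) {p q : α} :
    ∀ u : List σ, u.foldlM f p = some q →
      ∃ v : List σ, v.length < Fintype.card α ∧ v.foldlM f p = some q := by
  intro u
  induction hn : u.length using Nat.strong_induction_on generalizing u with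
  | _ n ih =>
    subst hn
    intro hu
    by_cases hlt : u.length < Fintype.card α
    · exact ⟨u, hlt, hu⟩
    have hsplit : ∀ i, ∃ r, (u.take i).foldlM f p = some r ∧ (u.drop i).foldlM f r = some q := by
      intro i
      rw [← List.take_append_drop i u, List.foldlM_append] at hu
      obtain ⟨r, hr, hr'⟩ := Option.bind_eq_some_iff.1 hu
      exact ⟨r, hr, hr'⟩
    choose r hr hr' using hsplit
    obtain ⟨i, j, hij, heq⟩ := Fintype.exists_ne_map_eq_of_card_lt
      (fun i : Fin (u.length + 1) => r i) (by simp; omega)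
    wlog hlt' : i < j generalizing i j
    · exact this j i hij.symm heq.symm (lt_of_le_of_ne (not_lt.1 hlt') hij.symm)
    have hj := j.2
    have hij' : (i : ℕ) < j := hlt'
    refine ih (u.take i ++ u.drop j).length (by simp; omega) _ rfl ?_
    rw [List.foldlM_append, hr]
    have heq' : r i = r j := heq
    simpa [heq'] using hr' j

/-- Two deterministic systems running in parallel. -/
def parallelStep (f : α → σ → Option α) (g : β → σ → Option β) (p : α × β) (a : σ) :
    Option (α × β) :=
  (f p.1 a).bind fun x => (g p.2 a).map fun y => (x, y)

theorem foldlM_parallelStep (f : α → σ → Option α) (g : β → σ → Option β) (p q : α × β)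
    (u : List σ) : u.foldlM (parallelStep f g) p = some q ↔
      u.foldlM f p.1 = some q.1 ∧ u.foldlM g p.2 = some q.2 := by
  induction u generalizing p with
  | nil => simp [Prod.ext_iff]
  | cons a u ih =>
    simp only [List.foldlM_cons, parallelStep, Option.bind_eq_bind, Option.bind_eq_some_iff,
      Option.map_eq_some_iff, ih]
    constructor
    · rintro ⟨_, ⟨x, hx, y, hy, rfl⟩, h⟩
      exact ⟨⟨x, hx, h.1⟩, y, hy, h.2⟩
    · rintro ⟨⟨x, hx, h⟩, y, hy, h'⟩
      exact ⟨_, ⟨x, hx, y, hy, rfl⟩, h, h'⟩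

theorem DFA.foldlM_step (A : DFA σ α) (p : α) (u : List σ) :
    (u.foldlM (fun p a => some (A.step p a)) p) = some (A.evalFrom p u) := by
  induction u generalizing p with
  | nil => rfl
  | cons a u ih => simp [ih]

end ShortPaths

/-! ### Runs of transducers and their shortening -/

namespace Transducer

variable {k m n n₁ n₂ s : ℕ}

theorem run_append (M : Transducer k m n) (q : Fin n) (u v : List (Fin k)) :
    M.run q (u ++ v) =
      (M.run q u).bind fun x => (M.run x.1 v).map fun y => (y.1, x.2 ++ y.2) := by
  induction u generalizing q with
  | nil => simp [run]
  | cons a u ih =>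
    simp only [List.cons_append, run, ih]
    cases M.step q a with
    | none => rfl
    | some x =>
      cases h : M.run x.1 u with
      | none => simp [h]
      | some y => cases h' : M.run y.1 v <;> simp [h, h']

theorem run_append_eq_some_iff {M : Transducer k m n} {q r : Fin n} {u v : List (Fin k)}
    {w : List (Fin m)} : M.run q (u ++ v) = some (r, w) ↔
      ∃ p x y, M.run q u = some (p, x) ∧ M.run p v = some (r, y) ∧ w = x ++ y := by
  simp only [run_append, Option.bind_eq_some_iff, Option.map_eq_some_iff, Prod.exists,
    Prod.mk.injEq]
  constructor
  · rintro ⟨p, x, h, _, y, h', rfl, rfl⟩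
    exact ⟨p, x, y, h, h', rfl⟩
  · rintro ⟨p, x, y, h, h', rfl⟩
    exact ⟨p, x, h, r, y, h', rfl, rfl⟩

theorem run_cons_eq_some_iff {M : Transducer k m n} {q r : Fin n} {a : Fin k}
    {v : List (Fin k)} {w : List (Fin m)} : M.run q (a :: v) = some (r, w) ↔
      ∃ p x y, M.step q a = some (p, x) ∧ M.run p v = some (r, y) ∧ w = x ++ y := by
  simp only [run, Option.bind_eq_some_iff, Option.map_eq_some_iff, Prod.exists, Prod.mk.injEq]
  constructor
  · rintro ⟨p, x, h, _, y, h', rfl, rfl⟩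
    exact ⟨p, x, y, h, h', rfl⟩
  · rintro ⟨p, x, y, h, h', rfl⟩
    exact ⟨p, x, h, r, y, h', rfl, rfl⟩

theorem semFrom_append {M : Transducer k m n} {q r : Fin n} {u : List (Fin k)}
    {w : List (Fin m)} (h : M.run q u = some (r, w)) (v : List (Fin k)) :
    M.semFrom q (u ++ v) = (M.semFrom r v).map fun x => w ++ x := by
  simp only [semFrom, run_append, h]
  cases h' : M.run r v with
  | none => simp [h']
  | some y => cases h'' : M.final y.1 <;> simp [h', h'']

/-- The transitions of a transducer without their outputs. -/
def move (M : Transducer k m n) (q : Fin n) (a : Fin k) : Option (Fin n) :=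
  (M.step q a).map Prod.fst

theorem foldlM_move (M : Transducer k m n) (q : Fin n) (u : List (Fin k)) :
    u.foldlM M.move q = (M.run q u).map Prod.fst := by
  induction u generalizing q with
  | nil => rfl
  | cons a u ih =>
    simp only [List.foldlM_cons, move, run, Option.bind_eq_bind]
    cases M.step q a with
    | none => rfl
    | some x => simpa [Function.comp_def] using ih x.1

theorem foldlM_move_eq_some {M : Transducer k m n} {q r : Fin n} {u : List (Fin k)} :
    u.foldlM M.move q = some r ↔ ∃ w, M.run q u = some (r, w) := by
  simp [foldlM_move]

theorem exists_short_run {M : Transducer k m n} {q r : Fin n} {u : List (Fin k)}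
    {w : List (Fin m)} (h : M.run q u = some (r, w)) :
    ∃ u' w', u'.length < n ∧ M.run q u' = some (r, w') := by
  obtain ⟨v, hv, hv'⟩ := exists_foldlM_length_lt_card M.move u (foldlM_move_eq_some.2 ⟨w, h⟩)
  obtain ⟨w', hw'⟩ := foldlM_move_eq_some.1 hv'
  exact ⟨v, w', by simpa using hv, hw'⟩

theorem semFrom_eq_some_iff {M : Transducer k m n} {q : Fin n} {u : List (Fin k)}
    {w : List (Fin m)} : M.semFrom q u = some w ↔
      ∃ r x y, M.run q u = some (r, x) ∧ M.final r = some y ∧ w = x ++ y := by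
  simp only [semFrom, Option.bind_eq_some_iff, Option.map_eq_some_iff, Prod.exists]
  constructor
  · rintro ⟨r, x, h, y, h', rfl⟩
    exact ⟨r, x, y, h, h', rfl⟩
  · rintro ⟨r, x, y, h, h', rfl⟩
    exact ⟨r, x, h, y, h', rfl⟩

theorem exists_short_semFrom {M : Transducer k m n} {q : Fin n} {u : List (Fin k)}
    {w : List (Fin m)} (h : M.semFrom q u = some w) :
    ∃ u' w', u'.length < n ∧ M.semFrom q u' = some w' := by
  obtain ⟨r, x, y, hr, hy, rfl⟩ := semFrom_eq_some_iff.1 h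
  obtain ⟨u', x', hu', hx'⟩ := exists_short_run hr
  exact ⟨u', x' ++ y, hu', semFrom_eq_some_iff.2 ⟨r, x', y, hx', hy, rfl⟩⟩

/-- This makes trimness decidable: finitely many words suffice as witnesses. -/
theorem isTrim_iff_short {M : Transducer k m n} : M.IsTrim ↔
    ∀ q, (∃ u w, u.length ≤ n ∧ M.run M.init u = some (q, w)) ∧
      (q = M.init ∨ ∃ u w, u.length ≤ n ∧ M.semFrom q u = some w) := by
  constructor
  · rintro ⟨h₁, h₂⟩ q
    obtain ⟨u, w, h⟩ := h₁ q
    obtain ⟨u, w, hu, h⟩ := exists_short_run h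
    refine ⟨⟨u, w, hu.le, h⟩, or_iff_not_imp_left.2 fun hq => ?_⟩
    obtain ⟨u, w, h⟩ := h₂ q hq
    obtain ⟨u, w, hu, h⟩ := exists_short_semFrom h
    exact ⟨u, w, hu.le, h⟩
  · intro h
    refine ⟨fun q => ?_, fun q hq => ?_⟩
    · obtain ⟨u, w, -, h⟩ := (h q).1
      exact ⟨u, w, h⟩
    · obtain ⟨u, w, -, h⟩ := (h q).2.resolve_left hq
      exact ⟨u, w, h⟩

/-! ### Short words that distinguish two transducers -/

section Distinguish

variable {M₁ : Transducer k m n₁} {M₂ : Transducer k m n₂} {A : DFA (Fin k) (Fin s)}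

/-- Loop removal in the product of both transducers and the automaton. The outputs of the shorter
runs are unrelated to `x₁` and `x₂`; only the states reached are kept. -/
theorem exists_short_joint_run {q₁ r₁ : Fin n₁} {q₂ r₂ : Fin n₂} {p : Fin s}
    {u : List (Fin k)} {x₁ x₂ : List (Fin m)} (h₁ : M₁.run q₁ u = some (r₁, x₁))
    (h₂ : M₂.run q₂ u = some (r₂, x₂)) :
    ∃ u' y₁ y₂, u'.length < n₁ * n₂ * s ∧ M₁.run q₁ u' = some (r₁, y₁) ∧
      M₂.run q₂ u' = some (r₂, y₂) ∧ A.evalFrom p u' = A.evalFrom p u := by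
  obtain ⟨v, hv, hv'⟩ := exists_foldlM_length_lt_card
    (parallelStep (parallelStep M₁.move M₂.move) fun p a => some (A.step p a))
    (p := ((q₁, q₂), p)) (q := ((r₁, r₂), A.evalFrom p u)) u
    ((foldlM_parallelStep _ _ _ _ _).2 ⟨(foldlM_parallelStep _ _ _ _ _).2
      ⟨foldlM_move_eq_some.2 ⟨_, h₁⟩, foldlM_move_eq_some.2 ⟨_, h₂⟩⟩, A.foldlM_step _ _⟩)
  rw [foldlM_parallelStep, foldlM_parallelStep, foldlM_move_eq_some, foldlM_move_eq_some,
    DFA.foldlM_step] at hv'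
  obtain ⟨⟨⟨y₁, h₁⟩, y₂, h₂⟩, h₃⟩ := hv'
  exact ⟨v, y₁, y₂, by simpa using hv, h₁, h₂, by simpa using h₃⟩

theorem exists_short_run_dfa {q₂ r₂ : Fin n₂} {p : Fin s}
    {u : List (Fin k)} {x₂ : List (Fin m)} (h₂ : M₂.run q₂ u = some (r₂, x₂)) :
    ∃ u' y₂, u'.length < n₂ * s ∧ M₂.run q₂ u' = some (r₂, y₂) ∧
      A.evalFrom p u' = A.evalFrom p u := by
  obtain ⟨v, hv, hv'⟩ := exists_foldlM_length_lt_card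
    (parallelStep M₂.move fun p a => some (A.step p a))
    (p := (q₂, p)) (q := (r₂, A.evalFrom p u)) u
    ((foldlM_parallelStep _ _ _ _ _).2 ⟨foldlM_move_eq_some.2 ⟨_, h₂⟩, A.foldlM_step _ _⟩)
  rw [foldlM_parallelStep, foldlM_move_eq_some, DFA.foldlM_step] at hv'
  obtain ⟨⟨y₂, h₂⟩, h₃⟩ := hv'
  exact ⟨v, y₂, by simpa using hv, h₂, by simpa using h₃⟩

theorem exists_short_joint_semFrom {q₁ : Fin n₁} {q₂ : Fin n₂} {p : Fin s}
    {u : List (Fin k)} {x₁ x₂ : List (Fin m)} (h₁ : M₁.semFrom q₁ u = some x₁)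
    (h₂ : M₂.semFrom q₂ u = some x₂) (hA : A.evalFrom p u ∈ A.accept) :
    ∃ u' y₁ y₂, u'.length < n₁ * n₂ * s ∧ M₁.semFrom q₁ u' = some y₁ ∧
      M₂.semFrom q₂ u' = some y₂ ∧ A.evalFrom p u' ∈ A.accept := by
  obtain ⟨r₁, x₁, z₁, hr₁, hz₁, rfl⟩ := semFrom_eq_some_iff.1 h₁
  obtain ⟨r₂, x₂, z₂, hr₂, hz₂, rfl⟩ := semFrom_eq_some_iff.1 h₂
  obtain ⟨u', y₁, y₂, hu', h₁, h₂, h₃⟩ := exists_short_joint_run (A := A) (p := p) hr₁ hr₂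
  exact ⟨u', y₁ ++ z₁, y₂ ++ z₂, hu', semFrom_eq_some_iff.2 ⟨_, _, _, h₁, hz₁, rfl⟩,
    semFrom_eq_some_iff.2 ⟨_, _, _, h₂, hz₂, rfl⟩, h₃ ▸ hA⟩

/-- A run that does not exist stops after a prefix. -/
theorem exists_stuck_of_run_eq_none {M : Transducer k m n} {q : Fin n} {u : List (Fin k)}
    (h : M.run q u = none) :
    ∃ x a y r w, u = x ++ a :: y ∧ M.run q x = some (r, w) ∧ M.step r a = none := by
  induction u generalizing q with
  | nil => simp [run] at h
  | cons a u ih =>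
    cases hs : M.step q a with
    | none => exact ⟨[], a, u, q, [], rfl, rfl, hs⟩
    | some z =>
      have h' : M.run z.1 u = none := by simpa [run, hs] using h
      obtain ⟨x, b, y, r, w, rfl, hr, hb⟩ := ih h'
      exact ⟨a :: x, b, y, r, z.2 ++ w, rfl, by simp [run, hs, hr], hb⟩

theorem sem_eq_none_iff {M : Transducer k m n} {u : List (Fin k)} :
    M.sem u = none ↔ M.semFrom M.init u = none := by
  simp [sem]

theorem sem_eq_some_iff {M : Transducer k m n} {u : List (Fin k)} {w : List (Fin m)} :
    M.sem u = some w ↔ ∃ x, M.semFrom M.init u = some x ∧ w = M.initOut ++ x := by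
  simp [sem, eq_comm]

/-- Domains depend only on the states visited, so loops can be removed. If `M₁` reads all of `v`,
one joint shortening is enough. If it gets stuck at a letter, the part before this letter is
shortened jointly; what follows matters only for `M₂` and `A`. -/
theorem exists_short_domain_difference {v : List (Fin k)} (hv : v ∈ A.accepts)
    (h₁ : M₁.sem v = none) (h₂ : M₂.sem v ≠ none) :
    ∃ u ∈ A.accepts, u.length < 2 * (n₁ * n₂ * s) ∧ M₁.sem u = none ∧ M₂.sem u ≠ none := by
  rw [sem_eq_none_iff] at h₁
  obtain ⟨w, hw⟩ := Option.ne_none_iff_exists'.1 (mt sem_eq_none_iff.2 h₂)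
  obtain ⟨r₂, x₂, y₂, hr₂, hy₂, rfl⟩ := semFrom_eq_some_iff.1 hw
  have hA : A.evalFrom A.start v ∈ A.accept := hv
  cases hrun : M₁.run M₁.init v with
  | some z =>
    obtain ⟨r₁, x₁⟩ := z
    obtain ⟨u, z₁, z₂, hu, hu₁, hu₂, hu₃⟩ :=
      exists_short_joint_run (A := A) (p := A.start) hrun hr₂
    refine ⟨u, ?_, by omega, ?_, ?_⟩
    · change A.evalFrom A.start u ∈ A.accept
      rwa [hu₃]
    · rw [sem_eq_none_iff]
      simp only [semFrom, hrun, hu₁, Option.bind_some, Option.map_eq_none_iff] at h₁ ⊢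
      exact h₁
    · rw [Ne, sem_eq_none_iff, semFrom_eq_some_iff.2 ⟨_, _, _, hu₂, hy₂, rfl⟩]
      simp
  | none =>
    obtain ⟨x, a, y, r₁, w, rfl, hr₁, ha⟩ := exists_stuck_of_run_eq_none hrun
    obtain ⟨s₂, w₂, _, hs₂, hs₂', rfl⟩ := run_append_eq_some_iff.1 hr₂
    obtain ⟨t₂, w₃, w₄, ht₂, ht₂', rfl⟩ := run_cons_eq_some_iff.1 hs₂'
    obtain ⟨x', z₁, z₂, hx', hx₁, hx₂, hx₃⟩ :=
      exists_short_joint_run (A := A) (p := A.start) hr₁ hs₂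
    obtain ⟨y', z₃, hy', hy₃, hy₄⟩ := exists_short_run_dfa (A := A)
      (p := A.step (A.evalFrom A.start x) a) ht₂'
    -- The total length is at most `(n₁ * n₂ * s - 1) + 1 + (n₂ * s - 1)`; the initial state of `M₁`
    -- shows that `n₁` is positive.
    have hle : n₂ * s ≤ n₁ * n₂ * s := by
      rw [mul_assoc]
      exact Nat.le_mul_of_pos_left _ (Fin.pos M₁.init)
    refine ⟨x' ++ a :: y', ?_, ?_, ?_, ?_⟩
    · change A.evalFrom A.start _ ∈ A.accept
      simp only [DFA.evalFrom_of_append, DFA.evalFrom_cons] at hA ⊢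
      rwa [hx₃, hy₄]
    · simp; omega
    · rw [sem_eq_none_iff, semFrom_append hx₁]
      simp [semFrom, run, ha]
    · rw [Ne, sem_eq_none_iff, semFrom_append hx₂, Option.map_eq_none_iff]
      simp [semFrom, run, ht₂, hy₃, hy₂]

end Distinguish

end Transducer

/-- The first equation makes one of `x₁`, `x₂` the other followed by a delay `d`. Since `y₁` and
`y₂` then differ by the same `d`, the second equation gives `x₁'`, `x₂'` this delay too. Hence
whatever completes the primed pair completes the unprimed one. -/
theorem append_eq_append_of_common_completion {α : Type*} {x₁ x₂ y₁ y₂ x₁' x₂' z₁ z₂ : List α}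
    (h : x₁ ++ y₁ = x₂ ++ y₂) (h' : x₁' ++ y₁ = x₂' ++ y₂) (hz : x₁' ++ z₁ = x₂' ++ z₂) :
    x₁ ++ z₁ = x₂ ++ z₂ := by
  rcases List.append_eq_append_iff.1 h with ⟨d, rfl, rfl⟩ | ⟨d, rfl, rfl⟩
  · rw [← List.append_assoc, List.append_cancel_right_eq] at h'
    subst h'
    simpa using hz
  · rw [← List.append_assoc, List.append_cancel_right_eq] at h'
    subst h'
    simpa using hz

namespace Transducer

variable {k m n n₁ n₂ s : ℕ}

section Distinguish

variable {M₁ : Transducer k m n₁} {M₂ : Transducer k m n₂} {A : DFA (Fin k) (Fin s)}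

/-- Agreement on short words is carried along a word of any length by induction on its prefixes. The
claim for a prefix concerns all short common completions `y`, since the inductive step has to pass
from one completion to another. -/
theorem semFrom_eq_of_short
    (H : ∀ u ∈ A.accepts, u.length < 2 * (n₁ * n₂ * s) → M₁.sem u = M₂.sem u)
    (u : List (Fin k)) : ∀ {q₁ q₂ x₁ x₂}, M₁.run M₁.init u = some (q₁, x₁) →
      M₂.run M₂.init u = some (q₂, x₂) → ∀ {y z₁ z₂}, y.length < n₁ * n₂ * s →
      M₁.semFrom q₁ y = some z₁ → M₂.semFrom q₂ y = some z₂ → u ++ y ∈ A.accepts →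
      M₁.initOut ++ (x₁ ++ z₁) = M₂.initOut ++ (x₂ ++ z₂) := by
  have test : ∀ {u y q₁ q₂ x₁ x₂ z₁ z₂}, M₁.run M₁.init u = some (q₁, x₁) →
      M₂.run M₂.init u = some (q₂, x₂) → M₁.semFrom q₁ y = some z₁ →
      M₂.semFrom q₂ y = some z₂ → u ++ y ∈ A.accepts →
      (u ++ y).length < 2 * (n₁ * n₂ * s) →
      M₁.initOut ++ (x₁ ++ z₁) = M₂.initOut ++ (x₂ ++ z₂) := by
    intro u y q₁ q₂ x₁ x₂ z₁ z₂ h₁ h₂ hz₁ hz₂ hA hl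
    simpa [sem, semFrom_append h₁, semFrom_append h₂, hz₁, hz₂] using H _ hA hl
  have accepts_append : ∀ u v, u ++ v ∈ A.accepts ↔
      A.evalFrom (A.evalFrom A.start u) v ∈ A.accept := by
    intro u v
    rw [← DFA.evalFrom_of_append]
    rfl
  induction u using List.reverseRecOn with
  | nil =>
    intro q₁ q₂ x₁ x₂ h₁ h₂ y z₁ z₂ hy hz₁ hz₂ hA
    exact test h₁ h₂ hz₁ hz₂ hA (by simp; omega)
  | append_singleton u a ih =>
    intro q₁ q₂ x₁ x₂ h₁ h₂ y z₁ z₂ hy hz₁ hz₂ hA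
    obtain ⟨p₁, v₁, t₁, hp₁, ht₁, rfl⟩ := run_append_eq_some_iff.1 h₁
    obtain ⟨p₂, v₂, t₂, hp₂, ht₂, rfl⟩ := run_append_eq_some_iff.1 h₂
    have hc₁ : M₁.semFrom p₁ (a :: y) = some (t₁ ++ z₁) := by
      simpa [hz₁] using semFrom_append ht₁ y
    have hc₂ : M₂.semFrom p₂ (a :: y) = some (t₂ ++ z₂) := by
      simpa [hz₂] using semFrom_append ht₂ y
    rw [List.append_assoc, List.singleton_append, accepts_append] at hA
    -- The completion `a :: y` of `u` may be one letter too long for the induction hypothesis, so it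
    -- is compared with a short completion `y'`. A short word `u'` with the same joint state as `u`
    -- transfers the comparison: `u ++ y'` is settled by induction, `u' ++ y'` and `u' ++ a :: y` by
    -- their length.
    obtain ⟨y', z₁', z₂', hy', hz₁', hz₂', hA'⟩ := exists_short_joint_semFrom hc₁ hc₂ hA
    have e₁ := ih hp₁ hp₂ hy' hz₁' hz₂' ((accepts_append _ _).2 hA')
    obtain ⟨u', v₁', v₂', hu', hu₁, hu₂, hu₃⟩ :=
      exists_short_joint_run (A := A) (p := A.start) hp₁ hp₂
    have e₂ := test hu₁ hu₂ hz₁' hz₂' ((accepts_append _ _).2 (hu₃ ▸ hA')) (by simp; omega)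
    have e₃ := test hu₁ hu₂ hc₁ hc₂ ((accepts_append _ _).2 (hu₃ ▸ hA)) (by simp; omega)
    rw [← List.append_assoc M₁.initOut, ← List.append_assoc M₂.initOut] at e₁ e₂ e₃
    simpa using append_eq_append_of_common_completion e₁ e₂ e₃

/-- Two transducers that differ on some word accepted by an automaton differ on a short one. -/
theorem exists_short_difference {v : List (Fin k)} (hv : v ∈ A.accepts)
    (h : M₁.sem v ≠ M₂.sem v) :
    ∃ u ∈ A.accepts, u.length < 2 * (n₁ * n₂ * s) ∧ M₁.sem u ≠ M₂.sem u := by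
  by_contra! H
  cases h₁ : M₁.sem v with
  | none =>
    obtain ⟨u, hu, hl, hu₁, hu₂⟩ :=
      exists_short_domain_difference hv h₁ fun h₂ => h (h₁.trans h₂.symm)
    exact hu₂ ((H u hu hl).symm.trans hu₁)
  | some w₁ =>
    cases h₂ : M₂.sem v with
    | none =>
      obtain ⟨u, hu, hl, hu₂, hu₁⟩ :=
        exists_short_domain_difference (M₁ := M₂) (M₂ := M₁) hv h₂ (by simp [h₁])
      exact hu₁ ((H u hu (by rwa [mul_comm n₁])).trans hu₂)
    | some w₂ =>
      obtain ⟨x₁, hx₁, rfl⟩ := sem_eq_some_iff.1 h₁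
      obtain ⟨x₂, hx₂, rfl⟩ := sem_eq_some_iff.1 h₂
      obtain ⟨r₁, y₁, z₁, hr₁, hz₁, rfl⟩ := semFrom_eq_some_iff.1 hx₁
      obtain ⟨r₂, y₂, z₂, hr₂, hz₂, rfl⟩ := semFrom_eq_some_iff.1 hx₂
      have := semFrom_eq_of_short H v hr₁ hr₂ (y := [])
        (Nat.mul_pos (Nat.mul_pos (Fin.pos M₁.init) (Fin.pos M₂.init)) (Fin.pos A.start))
        (by simp [semFrom, run, hz₁]; rfl) (by simp [semFrom, run, hz₂]; rfl) (by simpa using hv)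
      exact h (by rw [h₁, h₂, this])

end Distinguish

end Transducer

namespace Transducer

variable {k m n s : ℕ}

/-! ### Truncation of the outputs -/

/-- Cut all productions of a transducer to length at most `c`. -/
def truncate (M : Transducer k m n) (c : ℕ) : Transducer k m n where
  init := M.init
  initOut := M.initOut.take c
  step q a := (M.step q a).map fun x => (x.1, x.2.take c)
  final q := (M.final q).map (List.take c)

/-- All productions of the transducer have length at most `b`. -/
def OutputsLE (M : Transducer k m n) (b : ℕ) : Prop :=
  M.initOut.length ≤ b ∧ (∀ q a x, M.step q a = some x → x.2.length ≤ b) ∧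
    ∀ q w, M.final q = some w → w.length ≤ b

theorem outputsLE_truncate (M : Transducer k m n) {b c : ℕ} (h : c ≤ b) :
    (M.truncate c).OutputsLE b := by
  refine ⟨by simp [truncate, h], fun q a x hx => ?_, fun q w hw => ?_⟩
  · obtain ⟨y, -, rfl⟩ := Option.map_eq_some_iff.1 hx
    simp [h]
  · obtain ⟨y, -, rfl⟩ := Option.map_eq_some_iff.1 hw
    simp [h]

/-- The relation between an output and the outputs that remain of it after the productions have
been cut to the lengths `c` and `c + 1`. -/
structure IsTruncation {α : Type*} (c : ℕ) (w w' w'' : List α) : Prop where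
  length_le : w'.length ≤ w''.length
  eq_of_length_eq : w'.length = w''.length → w' = w
  eq_of_length_le : w.length ≤ c → w' = w

theorem IsTruncation.nil {α : Type*} (c : ℕ) : IsTruncation c ([] : List α) [] [] :=
  ⟨le_rfl, fun _ => rfl, fun _ => rfl⟩

theorem IsTruncation.take {α : Type*} (c : ℕ) (w : List α) :
    IsTruncation c w (w.take c) (w.take (c + 1)) := by
  refine ⟨by simp, fun h => ?_, fun h => List.take_of_length_le h⟩
  simp only [List.length_take] at h
  exact List.take_of_length_le (by omega)

/-- Lengths can only grow from cut `c` to cut `c + 1`, so equal total lengths force equal lengths in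
each factor. This is why `length_le` belongs to the structure. -/
theorem IsTruncation.append {α : Type*} {c : ℕ} {w w' w'' v v' v'' : List α}
    (h : IsTruncation c w w' w'') (h' : IsTruncation c v v' v'') :
    IsTruncation c (w ++ v) (w' ++ v') (w'' ++ v'') := by
  have h₁ := h.length_le
  have h₂ := h'.length_le
  refine ⟨by simp; omega, fun e => ?_, fun e => ?_⟩
  · simp only [List.length_append] at e
    rw [h.eq_of_length_eq (by omega), h'.eq_of_length_eq (by omega)]
  · simp only [List.length_append] at e
    rw [h.eq_of_length_le (by omega), h'.eq_of_length_le (by omega)]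

theorem run_truncate_of_eq_none {M : Transducer k m n} (c : ℕ) {q : Fin n} {u : List (Fin k)}
    (h : M.run q u = none) : (M.truncate c).run q u = none := by
  induction u generalizing q with
  | nil => simp [run] at h
  | cons a u ih =>
    cases hs : M.step q a with
    | none => simp [run, truncate, hs]
    | some x =>
      have h' : M.run x.1 u = none := by simpa [run, hs] using h
      have hs' : (M.truncate c).step q a = some (x.1, x.2.take c) := by simp [truncate, hs]
      simp [run, hs', ih h']

theorem run_truncate {M : Transducer k m n} (c : ℕ) {q r : Fin n} {u : List (Fin k)}
    {w : List (Fin m)} (h : M.run q u = some (r, w)) :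
    ∃ w' w'', (M.truncate c).run q u = some (r, w') ∧
      (M.truncate (c + 1)).run q u = some (r, w'') ∧ IsTruncation c w w' w'' := by
  induction u generalizing q w with
  | nil =>
    simp only [run, Option.some.injEq, Prod.mk.injEq] at h
    obtain ⟨rfl, rfl⟩ := h
    exact ⟨[], [], rfl, rfl, IsTruncation.nil c⟩
  | cons a u ih =>
    obtain ⟨p, x, y, hs, hr, rfl⟩ := run_cons_eq_some_iff.1 h
    obtain ⟨y', y'', h', h'', ht⟩ := ih hr
    exact ⟨x.take c ++ y', x.take (c + 1) ++ y'',
      run_cons_eq_some_iff.2 ⟨p, _, _, by simp [truncate, hs], h', rfl⟩,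
      run_cons_eq_some_iff.2 ⟨p, _, _, by simp [truncate, hs], h'', rfl⟩,
      (IsTruncation.take c x).append ht⟩

theorem semFrom_truncate_of_eq_none {M : Transducer k m n} (c : ℕ) {q : Fin n}
    {u : List (Fin k)} (h : M.semFrom q u = none) : (M.truncate c).semFrom q u = none := by
  cases hr : M.run q u with
  | none => simp [semFrom, run_truncate_of_eq_none c hr]
  | some x =>
    obtain ⟨w', w'', h', -⟩ := run_truncate c hr
    have hf : M.final x.1 = none := by simpa [semFrom, hr] using h
    have hf' : (M.truncate c).final x.1 = none := by simp [truncate, hf]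
    simp [semFrom, h', hf']

theorem semFrom_truncate {M : Transducer k m n} (c : ℕ) {q : Fin n} {u : List (Fin k)}
    {w : List (Fin m)} (h : M.semFrom q u = some w) :
    ∃ w' w'', (M.truncate c).semFrom q u = some w' ∧
      (M.truncate (c + 1)).semFrom q u = some w'' ∧ IsTruncation c w w' w'' := by
  obtain ⟨r, x, y, hr, hy, rfl⟩ := semFrom_eq_some_iff.1 h
  obtain ⟨x', x'', h', h'', ht⟩ := run_truncate c hr
  exact ⟨_, _, semFrom_eq_some_iff.2 ⟨r, x', y.take c, h', by simp [truncate, hy], rfl⟩,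
    semFrom_eq_some_iff.2 ⟨r, x'', y.take (c + 1), h'', by simp [truncate, hy], rfl⟩,
    ht.append (IsTruncation.take c y)⟩

theorem sem_truncate_of_eq_none {M : Transducer k m n} (c : ℕ) {u : List (Fin k)}
    (h : M.sem u = none) : (M.truncate c).sem u = none :=
  sem_eq_none_iff.2 (semFrom_truncate_of_eq_none c (sem_eq_none_iff.1 h))

theorem sem_truncate {M : Transducer k m n} (c : ℕ) {u : List (Fin k)}
    {w : List (Fin m)} (h : M.sem u = some w) :
    ∃ w' w'', (M.truncate c).sem u = some w' ∧
      (M.truncate (c + 1)).sem u = some w'' ∧ IsTruncation c w w' w'' := by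
  obtain ⟨x, hx, rfl⟩ := sem_eq_some_iff.1 h
  obtain ⟨x', x'', h', h'', ht⟩ := semFrom_truncate c hx
  exact ⟨_, _, sem_eq_some_iff.2 ⟨_, h', rfl⟩, sem_eq_some_iff.2 ⟨_, h'', rfl⟩,
    (IsTruncation.take c _).append ht⟩

theorem IsTrim.truncate {M : Transducer k m n} (h : M.IsTrim) (c : ℕ) :
    (M.truncate c).IsTrim := by
  refine ⟨fun q => ?_, fun q hq => ?_⟩
  · obtain ⟨u, w, hu⟩ := h.1 q
    obtain ⟨w', w'', h', -⟩ := run_truncate c hu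
    exact ⟨u, w', h'⟩
  · obtain ⟨u, w, hu⟩ := h.2 q hq
    obtain ⟨w', w'', h', -⟩ := semFrom_truncate c hu
    exact ⟨u, w', h'⟩

/-! ### Truncation preserves compatibility and minimality -/

section Table

variable {A : DFA (Fin k) (Fin s)} {τ : List (Fin k) → Option (List (Fin m))}
  {T : ObservationTable A τ}

theorem IsCompatible.truncate {M : Transducer k m n} (h : M.IsCompatible T) {c : ℕ}
    (hc : ∀ u ∈ tableRows T.P, ∀ v ∈ T.S, ∀ w, T.entry (u ++ v) = .out w → w.length ≤ c) :
    (M.truncate c).IsCompatible T := by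
  refine fun u hu v hv => ⟨fun w hw => ?_, fun hb => ?_⟩
  · obtain ⟨w', w'', h', -, ht⟩ := sem_truncate c ((h u hu v hv).1 w hw)
    rw [h', ht.eq_of_length_le (hc u hu v hv w hw)]
  · exact sem_truncate_of_eq_none c ((h u hu v hv).2 hb)

theorem IsMinimalCompatible.truncate {M : Transducer k m n} (h : M.IsMinimalCompatible T) {c : ℕ}
    (hc : ∀ u ∈ tableRows T.P, ∀ v ∈ T.S, ∀ w, T.entry (u ++ v) = .out w → w.length ≤ c) :
    (M.truncate c).IsMinimalCompatible T :=
  ⟨h.1.truncate c, h.2.1.truncate hc, h.2.2⟩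

/-- If two minimal transducers differ on a word of the upper bound, then so do two that have short
productions and the same number of states. -/
theorem exists_isCompeting_outputsLE {n₁ n₂ : ℕ} {M₁ : Transducer k m n₁}
    {M₂ : Transducer k m n₂} {v : List (Fin k)} (h : T.IsCompeting M₁ M₂ v) {c : ℕ}
    (hc : ∀ u ∈ tableRows T.P, ∀ v ∈ T.S, ∀ w, T.entry (u ++ v) = .out w → w.length ≤ c) :
    ∃ (n : ℕ) (N₁ N₂ : Transducer k m n), T.IsCompeting N₁ N₂ v ∧ N₁.OutputsLE (c + 1) ∧
      N₂.OutputsLE (c + 1) := by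
  obtain ⟨h₁, h₂, hv, hne⟩ := h
  obtain rfl : n₁ = n₂ :=
    le_antisymm (h₁.2.2 _ M₂ h₂.1 h₂.2.1) (h₂.2.2 _ M₁ h₁.1 h₁.2.1)
  have hc' : ∀ u ∈ tableRows T.P, ∀ v ∈ T.S, ∀ w, T.entry (u ++ v) = .out w →
      w.length ≤ c + 1 := fun u hu v hv w hw => (hc u hu v hv w hw).trans (Nat.le_succ c)
  -- If the cut at `c` changes the value at `v`, then a production was really shortened there, and
  -- the cut at `c + 1` keeps strictly more of it.
  have key : ∀ M : Transducer k m n₁, M.IsMinimalCompatible T →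
      (M.truncate c).sem v ≠ M.sem v →
      (M.truncate c).sem v ≠ (M.truncate (c + 1)).sem v := by
    intro M hM hMv e
    cases hs : M.sem v with
    | none => exact hMv ((sem_truncate_of_eq_none c hs).trans hs.symm)
    | some w =>
      obtain ⟨w', w'', h', h'', ht⟩ := sem_truncate c hs
      rw [h', h'', Option.some.injEq] at e
      rw [h', hs, ht.eq_of_length_eq (by rw [e])] at hMv
      exact hMv rfl
  by_cases e₁ : (M₁.truncate c).sem v = M₁.sem v
  · by_cases e₂ : (M₂.truncate c).sem v = M₂.sem v
    · exact ⟨n₁, _, _, ⟨h₁.truncate hc, h₂.truncate hc, hv, by rwa [e₁, e₂]⟩,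
        outputsLE_truncate _ (Nat.le_succ c), outputsLE_truncate _ (Nat.le_succ c)⟩
    · exact ⟨n₁, _, _, ⟨h₂.truncate hc, h₂.truncate hc', hv, key M₂ h₂ e₂⟩,
        outputsLE_truncate _ (Nat.le_succ c), outputsLE_truncate _ le_rfl⟩
  · exact ⟨n₁, _, _, ⟨h₁.truncate hc, h₁.truncate hc', hv, key M₁ h₁ e₁⟩,
      outputsLE_truncate _ (Nat.le_succ c), outputsLE_truncate _ le_rfl⟩

end Table

/-! ### The prefix tree transducer -/

/-- The states are the prefixes of words of `l`, transitions produce nothing, and the whole output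
is emitted at the end. The empty word is always a state, which accounts for the final `+ 1`; if `l`
is empty, it is the only state and reaches no final state, as `IsTrim` permits for the initial
state. -/
theorem exists_trim_transducer_of_list (l : List (List (Fin k)))
    (f : List (Fin k) → List (Fin m)) :
    ∃ (n : ℕ) (M : Transducer k m n), M.IsTrim ∧
      (∀ u, M.sem u = if u ∈ l then some (f u) else none) ∧
      n ≤ (l.map fun u => u.length + 1).sum + 1 := by
  let V : Finset (List (Fin k)) := ([] :: l.flatMap List.inits).toFinset
  have hV : ∀ u, u ∈ V ↔ u = [] ∨ ∃ v, u ++ v ∈ l := by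
    intro u
    simp only [V, List.mem_toFinset, List.mem_cons, List.mem_flatMap, List.mem_inits]
    refine or_congr_right ⟨?_, ?_⟩
    · rintro ⟨_, h, v, rfl⟩
      exact ⟨v, h⟩
    · rintro ⟨v, h⟩
      exact ⟨_, h, v, rfl⟩
  have hprefix : ∀ u v, u ++ v ∈ V → u ∈ V := by
    intro u v h
    rcases (hV _).1 h with h | ⟨w, h⟩
    · exact (hV _).2 (Or.inl (List.append_eq_nil_iff.1 h).1)
    · exact (hV _).2 (Or.inr ⟨v ++ w, by rwa [← List.append_assoc]⟩)
  let e : V ≃ Fin V.card := V.equivFin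
  let root : V := ⟨[], (hV _).2 (Or.inl rfl)⟩
  let M : Transducer k m V.card :=
    { init := e root
      initOut := []
      step := fun q a => if h : (e.symm q).1 ++ [a] ∈ V then some (e ⟨_, h⟩, []) else none
      final := fun q => if (e.symm q).1 ∈ l then some (f (e.symm q).1) else none }
  have hrun : ∀ (u : List (Fin k)) (x : V),
      M.run (e x) u = if h : x.1 ++ u ∈ V then some (e ⟨_, h⟩, []) else none := by
    intro u
    induction u with
    | nil => intro x; simp [run]
    | cons a u ih =>
      intro x
      by_cases hx : x.1 ++ [a] ∈ V
      · have hs : M.step (e x) a = some (e ⟨_, hx⟩, []) := by simp [M, hx]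
        simp only [run, hs, Option.bind_some, ih]
        by_cases hu : x.1 ++ a :: u ∈ V <;> simp [hu]
      · have hs : M.step (e x) a = none := by simp [M, hx]
        have hu : x.1 ++ a :: u ∉ V := fun h => hx (hprefix _ u (by simpa using h))
        simp [run, hs, hu]
  have hsem : ∀ (u : List (Fin k)) (x : V),
      M.semFrom (e x) u = if x.1 ++ u ∈ l then some (f (x.1 ++ u)) else none := by
    intro u x
    by_cases h : x.1 ++ u ∈ V
    · have hf : M.final (e ⟨_, h⟩) = if x.1 ++ u ∈ l then some (f (x.1 ++ u)) else none := by
        simp [M]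
      simp [semFrom, hrun, h, hf]
    · have : x.1 ++ u ∉ l := fun h' => h ((hV _).2 (Or.inr ⟨[], by simpa using h'⟩))
      simp [semFrom, hrun, h, this]
  refine ⟨V.card, M, ⟨fun q => ?_, fun q hq => ?_⟩, fun u => ?_, ?_⟩
  · obtain ⟨x, rfl⟩ := e.surjective q
    exact ⟨x.1, [], (hrun _ root).trans (by simp [root])⟩
  · obtain ⟨x, rfl⟩ := e.surjective q
    rcases (hV _).1 x.2 with h | ⟨v, h⟩
    · exact absurd (congrArg e (Subtype.ext h)) hq
    · exact ⟨v, f (x.1 ++ v), (hsem v x).trans (if_pos h)⟩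
  · have h : M.semFrom M.init u = if u ∈ l then some (f u) else none := hsem u root
    simp only [sem, h]
    exact Option.map_id'
  · refine (List.toFinset_card_le _).trans ?_
    simp [List.length_flatMap]

end Transducer

/-! ### Correctness of the algorithms on codes -/

section Words

variable {k m n s b : ℕ}

theorem wordCode_eq_map (u : List (Fin k)) : wordCode u = u.map Fin.val := by
  induction u <;> simp_all [wordCode]

@[simp] theorem length_wordCode (u : List (Fin k)) : (wordCode u).length = u.length := by
  simp [wordCode_eq_map]

@[simp] theorem wordCode_append (u v : List (Fin k)) :
    wordCode (u ++ v) = wordCode u ++ wordCode v := by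
  simp [wordCode_eq_map]

theorem wordCode_cons (a : Fin k) (u : List (Fin k)) :
    wordCode (a :: u) = (a : ℕ) :: wordCode u := by
  simp [wordCode_eq_map]

theorem wordCode_injective : Function.Injective (wordCode (k := k)) :=
  fun u v h => List.map_injective_iff.2 Fin.val_injective (by
    simpa only [wordCode_eq_map] using h)

theorem mem_wordsUpTo {L : ℕ} {x : List ℕ} :
    x ∈ wordsUpTo k L ↔ ∃ u : List (Fin k), u.length ≤ L ∧ wordCode u = x := by
  simp only [wordsUpTo, List.mem_flatMap, List.mem_range, mem_tuples]
  constructor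
  · rintro ⟨i, hi, rfl, hx⟩
    have hx' : x ∈ Set.range (List.map (Fin.val : Fin k → ℕ)) := by
      rw [Set.range_list_map]
      exact fun a ha => ⟨⟨a, hx a ha⟩, rfl⟩
    obtain ⟨u, rfl⟩ := hx'
    exact ⟨u, by simpa [Nat.lt_succ_iff] using hi, wordCode_eq_map u⟩
  · rintro ⟨u, hu, rfl⟩
    refine ⟨u.length, by omega, by simp, fun a ha => ?_⟩
    rw [wordCode_eq_map] at ha
    obtain ⟨c, -, rfl⟩ := List.mem_map.1 ha
    exact c.2

theorem mem_optionsOf {α : Type*} {l : List α} {o : Option α} :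
    o ∈ optionsOf l ↔ ∀ a, o = some a → a ∈ l := by
  cases o <;> simp [optionsOf]

theorem ofFn_mem_tuples {α : Type*} {l : List α} {g : Fin n → α} :
    List.ofFn g ∈ tuples l n ↔ ∀ i, g i ∈ l := by
  simp [mem_tuples, List.mem_ofFn]

/-- Decodes a tuple entry by entry. The predicate `p` carries the length bounds, so that the lemma
can be nested for the rows of a transducer and their entries. -/
theorem exists_ofFn_of_mem_tuples {α β : Type*} {l : List α} {x : List α} (hx : x ∈ tuples l n)
    {p : β → Prop} {f : β → α} (hl : ∀ a ∈ l, ∃ b, p b ∧ f b = a) :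
    ∃ g : Fin n → β, (∀ i, p (g i)) ∧ List.ofFn (fun i => f (g i)) = x := by
  obtain ⟨rfl, hx'⟩ := mem_tuples.1 hx
  choose g hg using fun i : Fin x.length => hl x[i] (hx' _ (List.getElem_mem i.2))
  refine ⟨g, fun i => (hg i).1, ?_⟩
  apply List.ext_getElem <;> simp [hg]

theorem exists_option_of_mem_optionsOf {α β : Type*} {l : List α} {o : Option α}
    (ho : o ∈ optionsOf l) {p : β → Prop} {f : β → α} (hl : ∀ a ∈ l, ∃ b, p b ∧ f b = a) :
    ∃ o' : Option β, (∀ b, o' = some b → p b) ∧ o'.map f = o := by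
  cases o with
  | none => exact ⟨none, by simp, rfl⟩
  | some a =>
    obtain ⟨b, hb, rfl⟩ := hl a (mem_optionsOf.1 ho a rfl)
    exact ⟨some b, by simpa using hb, rfl⟩

/-- The enumeration is complete within the bound and contains no ill-formed code; the latter lets
every answer of the search be decoded. -/
theorem mem_transducerCodes {C : TransducerCode} :
    C ∈ transducerCodes k m n b ↔ ∃ M : Transducer k m n, M.OutputsLE b ∧ M.code = C := by
  have hwords : ∀ a ∈ wordsUpTo m b, ∃ w : List (Fin m), w.length ≤ b ∧ wordCode w = a :=
    fun a ha => mem_wordsUpTo.1 ha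
  constructor
  · intro h
    obtain ⟨i, w, rows⟩ := C
    simp only [transducerCodes, List.pair_mem_product, List.mem_range] at h
    obtain ⟨hi, hw, hrows⟩ := h
    obtain ⟨w, hwl, rfl⟩ := hwords w hw
    obtain ⟨g, hg, rfl⟩ := exists_ofFn_of_mem_tuples hrows
      (p := fun x : (Fin k → Option (Fin n × List (Fin m))) × Option (List (Fin m)) =>
        (∀ a y, x.1 a = some y → y.2.length ≤ b) ∧ ∀ y, x.2 = some y → y.length ≤ b)
      (f := fun x => (List.ofFn fun a => (x.1 a).map fun y => ((y.1 : ℕ), wordCode y.2),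
        x.2.map wordCode)) (by
        rintro ⟨r, o⟩ h
        obtain ⟨hr, ho⟩ := List.pair_mem_product.1 h
        obtain ⟨o, ho', rfl⟩ := exists_option_of_mem_optionsOf ho hwords
        obtain ⟨r, hr', rfl⟩ := exists_ofFn_of_mem_tuples hr
          (p := fun x : Option (Fin n × List (Fin m)) => ∀ y, x = some y → y.2.length ≤ b)
          (f := fun x => x.map fun y => ((y.1 : ℕ), wordCode y.2)) (by
            intro t ht
            refine exists_option_of_mem_optionsOf ht
              (p := fun y : Fin n × List (Fin m) => y.2.length ≤ b) ?_
            rintro ⟨q, x⟩ h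
            obtain ⟨hq, hx⟩ := List.pair_mem_product.1 h
            obtain ⟨x, hx', rfl⟩ := hwords x hx
            exact ⟨(⟨q, List.mem_range.1 hq⟩, x), hx', rfl⟩)
        exact ⟨(r, o), ⟨hr', ho'⟩, rfl⟩)
    exact ⟨⟨⟨i, hi⟩, w, fun q => (g q).1, fun q => (g q).2⟩,
      ⟨hwl, fun q => (hg q).1, fun q => (hg q).2⟩, rfl⟩
  · rintro ⟨M, ⟨h₁, h₂, h₃⟩, rfl⟩
    refine List.pair_mem_product.2 ⟨List.mem_range.2 M.init.2, List.pair_mem_product.2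
      ⟨mem_wordsUpTo.2 ⟨_, h₁, rfl⟩, ofFn_mem_tuples.2 fun q => List.pair_mem_product.2
        ⟨ofFn_mem_tuples.2 fun a => mem_optionsOf.2 ?_, mem_optionsOf.2 ?_⟩⟩⟩
    · rintro _ h
      obtain ⟨y, hy, rfl⟩ := Option.map_eq_some_iff.1 h
      exact List.pair_mem_product.2 ⟨List.mem_range.2 y.1.2, mem_wordsUpTo.2 ⟨_, h₂ q a y hy, rfl⟩⟩
    · rintro _ h
      obtain ⟨y, hy, rfl⟩ := Option.map_eq_some_iff.1 h
      exact mem_wordsUpTo.2 ⟨_, h₃ q y hy, rfl⟩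

end Words

/-! ### Evaluation of coded transducers and automata -/

namespace Transducer

variable {k m n s b : ℕ}

@[simp] theorem length_code (M : Transducer k m n) : M.code.2.2.length = n := by
  simp [code]

theorem code_getElem? (M : Transducer k m n) (q : Fin n) : M.code.2.2[(q : ℕ)]? =
    some (List.ofFn fun a => (M.step q a).map fun x => ((x.1 : ℕ), wordCode x.2),
      (M.final q).map wordCode) := by
  simp [code]

/-- `runCode` accumulates output from the left, whereas `run` prepends it on return; the arbitrary
accumulator `x` makes the induction work. -/
theorem runCode_code (M : Transducer k m n) (q : Fin n) (x : List ℕ) (u : List (Fin k)) :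
    runCode M.code (q, x) (wordCode u) =
      (M.run q u).map fun y => ((y.1 : ℕ), x ++ wordCode y.2) := by
  induction u generalizing q x with
  | nil => simp [runCode, run, wordCode]
  | cons a u ih =>
    have hnone : ∀ l : List ℕ, l.foldl (fun o a => o.bind fun x : ℕ × List ℕ =>
        (M.code.2.2[x.1]?).bind fun r => (r.1[a]?).bind fun t =>
          t.map fun y => (y.1, x.2 ++ y.2)) none = none := by
      intro l
      induction l with
      | nil => rfl
      | cons a l ih => simpa using ih
    rw [wordCode_cons]
    simp only [runCode, List.foldl_cons, Option.bind_some, code_getElem?]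
    cases hs : M.step q a with
    | none => simpa [run, hs] using hnone _
    | some y =>
      have := ih y.1 (x ++ wordCode y.2)
      simp only [runCode] at this
      simp [run, hs, this, Function.comp_def]

theorem evalCode_code (M : Transducer k m n) (q : Fin n) (x : List ℕ) (u : List (Fin k)) :
    evalCode M.code (q, x) (wordCode u) = (M.semFrom q u).map fun w => x ++ wordCode w := by
  simp only [evalCode, runCode_code, semFrom]
  cases M.run q u with
  | none => rfl
  | some y =>
    simp only [Option.map_some, Option.bind_some, code_getElem?]
    cases M.final y.1 <;> simp

theorem semCode_code (M : Transducer k m n) (u : List (Fin k)) :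
    semCode M.code (wordCode u) = (M.sem u).map wordCode := by
  have h : semCode M.code (wordCode u) =
      evalCode M.code (M.init, wordCode M.initOut) (wordCode u) := rfl
  rw [h, evalCode_code, sem, Option.map_map]
  simp [Function.comp_def]

theorem trimCode_code (M : Transducer k m n) : trimCode k M.code = true ↔ M.IsTrim := by
  have hinit : M.code.1 = M.init := rfl
  have h₁ : ∀ q : Fin n, (∃ x ∈ wordsUpTo k n,
      (runCode M.code (M.code.1, []) x).map Prod.fst = some (q : ℕ)) ↔
      ∃ u w, u.length ≤ n ∧ M.run M.init u = some (q, w) := by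
    intro q
    constructor
    · rintro ⟨x, hx, h⟩
      obtain ⟨u, hu, rfl⟩ := mem_wordsUpTo.1 hx
      rw [hinit, runCode_code, Option.map_map, Option.map_eq_some_iff] at h
      obtain ⟨⟨r, w⟩, h, h'⟩ := h
      obtain rfl := Fin.val_injective h'
      exact ⟨u, w, hu, h⟩
    · rintro ⟨u, w, hu, h⟩
      exact ⟨_, mem_wordsUpTo.2 ⟨u, hu, rfl⟩, by simp [hinit, runCode_code, h]⟩
  have h₂ : ∀ q : Fin n, (∃ x ∈ wordsUpTo k n, (evalCode M.code (q, []) x).isSome = true) ↔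
      ∃ u w, u.length ≤ n ∧ M.semFrom q u = some w := by
    intro q
    constructor
    · rintro ⟨x, hx, h⟩
      obtain ⟨u, hu, rfl⟩ := mem_wordsUpTo.1 hx
      rw [evalCode_code, Option.isSome_map, Option.isSome_iff_exists] at h
      obtain ⟨w, h⟩ := h
      exact ⟨u, w, hu, h⟩
    · rintro ⟨u, w, hu, h⟩
      exact ⟨_, mem_wordsUpTo.2 ⟨u, hu, rfl⟩, by simp [evalCode_code, h]⟩
  rw [isTrim_iff_short]
  simp only [trimCode, length_code, List.all_eq_true, List.mem_range, Bool.and_eq_true,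
    Bool.or_eq_true, List.any_eq_true, decide_eq_true_eq]
  constructor
  · intro h q
    refine ⟨(h₁ q).1 (h q q.2).1, (h q q.2).2.imp (fun h => Fin.val_injective h) (h₂ q).1⟩
  · intro h q hq
    exact ⟨(h₁ ⟨q, hq⟩).2 (h ⟨q, hq⟩).1,
      (h ⟨q, hq⟩).2.imp (fun h => congrArg Fin.val h) (h₂ ⟨q, hq⟩).2⟩

end Transducer

theorem acceptsCode_dfaCode {k s : ℕ} (A : DFA (Fin k) (Fin s)) (u : List (Fin k)) :
    acceptsCode (dfaCode A) (wordCode u) = true ↔ u ∈ A.accepts := by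
  have hrow : ∀ p : Fin s, (dfaCode A).2[(p : ℕ)]? =
      some (List.ofFn fun a => (A.step p a : ℕ),
        @decide (p ∈ A.accept) (Classical.propDecidable _)) := by
    intro p
    simp [dfaCode]
  have hfold : ∀ (u : List (Fin k)) (p : Fin s), (wordCode u).foldl
      (fun q a => (((dfaCode A).2[q]?).bind fun r => r.1[a]?).getD 0) (p : ℕ) =
        (A.evalFrom p u : ℕ) := by
    intro u
    induction u with
    | nil => intro p; rfl
    | cons a u ih =>
      intro p
      rw [wordCode_cons, List.foldl_cons, hrow]
      simpa using ih (A.step p a)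
  have hstart : (dfaCode A).1 = (A.start : ℕ) := rfl
  rw [acceptsCode, hstart, hfold, hrow]
  simp only [Option.map_some, Option.getD_some, decide_eq_true_eq]
  rfl

/-! ### The searches applied to the code of a table -/

namespace ObservationTable

variable {k m n s : ℕ} {A : DFA (Fin k) (Fin s)} {τ : List (Fin k) → Option (List (Fin m))}

theorem rowsCode_map_wordCode (P : List (List (Fin k))) :
    rowsCode k (P.map wordCode) = (tableRows P).map wordCode := by
  simp only [rowsCode, tableRows, List.map_append, List.flatMap_map, List.map_flatMap,
    List.map_map, ← List.map_coe_finRange_eq_range]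
  simp [Function.comp_def, wordCode]

/-- The words of the table. -/
def words (T : ObservationTable A τ) : List (List (Fin k)) :=
  (tableRows T.P).flatMap fun u => T.S.map fun v => u ++ v

theorem mem_words {T : ObservationTable A τ} {w : List (Fin k)} :
    w ∈ T.words ↔ ∃ u ∈ tableRows T.P, ∃ v ∈ T.S, u ++ v = w := by
  simp [words]

theorem tableWords_inputCode (T : ObservationTable A τ) :
    tableWords T.inputCode = T.words.map fun w => (wordCode w, (T.entry w).code) := by
  have h : tableWords T.inputCode = (pairUp (rowsCode k (T.P.map wordCode))
      ((tableRows T.P).map fun u => T.S.map fun v => (T.entry (u ++ v)).code)).flatMap fun x =>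
        (pairUp (T.S.map wordCode) x.2).map fun y => (x.1 ++ y.1, y.2) := rfl
  rw [h, rowsCode_map_wordCode, pairUp_map, List.flatMap_map, words, List.map_flatMap]
  simp [pairUp_map, Function.comp_def]

theorem isCompatible_iff {T : ObservationTable A τ} {M : Transducer k m n} :
    M.IsCompatible T ↔ ∀ w ∈ T.words, (∀ x, T.entry w = .out x → M.sem w = some x) ∧
      (T.entry w = .bot → M.sem w = none) := by
  constructor
  · intro h w hw
    obtain ⟨u, hu, v, hv, rfl⟩ := mem_words.1 hw
    exact h u hu v hv
  · exact fun h u hu v hv => h _ (mem_words.2 ⟨u, hu, v, hv, rfl⟩)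

theorem compatibleCode_code {T : ObservationTable A τ} {M : Transducer k m n} :
    compatibleCode T.inputCode M.code = true ↔ M.IsCompatible T := by
  rw [isCompatible_iff, compatibleCode, tableWords_inputCode, List.all_eq_true]
  simp only [List.forall_mem_map, Bool.or_eq_true, decide_eq_true_eq, Transducer.semCode_code]
  refine forall₂_congr fun w _ => ?_
  cases T.entry w with
  | hash => simp [TableEntry.code]
  | bot => simp [TableEntry.code, eq_comm]
  | out x =>
    have h : (M.sem w).map wordCode = some (wordCode x) ↔ M.sem w = some x :=
      (Option.map_injective wordCode_injective).eq_iff (b := some x)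
    simp [TableEntry.code, eq_comm (a := some (wordCode x)), h]

theorem length_le_outputBound (T : ObservationTable A τ) {w : List (Fin k)} (hw : w ∈ T.words)
    {x : List (Fin m)} (hx : T.entry w = .out x) : x.length ≤ outputBound T.inputCode := by
  rw [outputBound, tableWords_inputCode]
  refine List.single_le_sum (fun _ _ => Nat.zero_le _) _ (List.mem_map.2
    ⟨_, List.mem_map.2 ⟨w, hw, rfl⟩, ?_⟩)
  simp [hx, TableEntry.code]

theorem exists_trim_compatible (T : ObservationTable A τ) :
    ∃ (n : ℕ) (M : Transducer k m n), M.IsTrim ∧ M.IsCompatible T ∧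
      n ≤ stateBound T.inputCode := by
  classical
  obtain ⟨n, M, hM, hsem, hn⟩ := Transducer.exists_trim_transducer_of_list
    (T.words.filter fun w => decide (∃ x, T.entry w = .out x))
    fun w => match T.entry w with
      | .out x => x
      | _ => []
  refine ⟨n, M, hM, isCompatible_iff.2 fun w hw => ⟨fun x hx => ?_, fun hb => ?_⟩, hn.trans ?_⟩
  · rw [hsem, if_pos (by simp [hw, hx]), hx]
  · rw [hsem, if_neg (by simp [hb])]
  · rw [stateBound, tableWords_inputCode]
    simp only [List.map_map, Function.comp_def, length_wordCode]
    -- The tree is built from the words with an output only, while `stateBound` counts the prefixes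
    -- of all words of the table.
    exact Nat.succ_le_succ
      ((List.filter_sublist.map _).sum_le_sum fun _ _ => Nat.zero_le _)

theorem exists_isMinimalCompatible (T : ObservationTable A τ) :
    ∃ (n : ℕ) (M : Transducer k m n), M.IsMinimalCompatible T := by
  classical
  have h : ∃ n, ∃ M : Transducer k m n, M.IsTrim ∧ M.IsCompatible T := by
    obtain ⟨n, M, h₁, h₂, -⟩ := T.exists_trim_compatible
    exact ⟨n, M, h₁, h₂⟩
  obtain ⟨M, h₁, h₂⟩ := Nat.find_spec h
  exact ⟨Nat.find h, M, h₁, h₂, fun n' M' h₁' h₂' => Nat.find_min' h ⟨M', h₁', h₂'⟩⟩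

theorem outputs_le (T : ObservationTable A τ) : ∀ u ∈ tableRows T.P, ∀ v ∈ T.S, ∀ w,
    T.entry (u ++ v) = .out w → w.length ≤ outputBound T.inputCode :=
  fun u hu v hv _ hw => T.length_le_outputBound (mem_words.2 ⟨u, hu, v, hv, rfl⟩) hw

theorem mem_goodCodes {T : ObservationTable A τ} {C : TransducerCode} :
    C ∈ goodCodes T.inputCode ↔ ∃ (n : ℕ) (M : Transducer k m n),
      n ≤ stateBound T.inputCode ∧ M.OutputsLE (outputBound T.inputCode + 1) ∧
        M.IsCompatible T ∧ M.IsTrim ∧ M.code = C := by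
  have h : goodCodes T.inputCode = (List.range (stateBound T.inputCode + 1)).flatMap fun n =>
    (transducerCodes k m n (outputBound T.inputCode + 1)).filter fun M =>
      compatibleCode T.inputCode M && trimCode k M := rfl
  simp only [h, List.mem_flatMap, List.mem_range, List.mem_filter, Bool.and_eq_true,
    mem_transducerCodes, Nat.lt_succ_iff]
  constructor
  · rintro ⟨n, hn, ⟨M, hb, rfl⟩, hc, ht⟩
    exact ⟨n, M, hn, hb, compatibleCode_code.1 hc, M.trimCode_code.1 ht, rfl⟩
  · rintro ⟨n, M, hn, hb, hc, ht, rfl⟩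
    exact ⟨n, hn, ⟨M, hb, rfl⟩, compatibleCode_code.2 hc, M.trimCode_code.2 ht⟩

/-- Being smallest within the finite list is the same as being smallest among all trim compatible
transducers, because the truncation of a minimal transducer lies in the list. -/
theorem mem_minimalCodes {T : ObservationTable A τ} {C : TransducerCode} :
    C ∈ minimalCodes T.inputCode ↔ ∃ (n : ℕ) (M : Transducer k m n),
      M.OutputsLE (outputBound T.inputCode + 1) ∧ M.IsMinimalCompatible T ∧ M.code = C := by
  have hsmall : ∀ (n : ℕ) (M : Transducer k m n), M.IsMinimalCompatible T →
      n ≤ stateBound T.inputCode := by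
    intro n M hM
    obtain ⟨n', M', h₁, h₂, h₃⟩ := T.exists_trim_compatible
    exact (hM.2.2 n' M' h₁ h₂).trans h₃
  simp only [minimalCodes, List.mem_filter, List.all_eq_true, decide_eq_true_eq]
  constructor
  · rintro ⟨hC, hmin⟩
    obtain ⟨n, M, hn, hb, hc, ht, rfl⟩ := mem_goodCodes.1 hC
    refine ⟨n, M, hb, ⟨ht, hc, fun n' M' ht' hc' => ?_⟩, rfl⟩
    obtain ⟨n₀, M₀, hM₀⟩ := T.exists_isMinimalCompatible
    have := hmin (M₀.truncate (outputBound T.inputCode)).code (mem_goodCodes.2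
      ⟨n₀, _, hsmall _ _ hM₀, Transducer.outputsLE_truncate _ (Nat.le_succ _),
        hM₀.2.1.truncate T.outputs_le, hM₀.1.truncate _, rfl⟩)
    rw [Transducer.length_code, Transducer.length_code] at this
    exact this.trans (hM₀.2.2 n' M' ht' hc')
  · rintro ⟨n, M, hb, hM, rfl⟩
    refine ⟨mem_goodCodes.2 ⟨n, M, hsmall _ _ hM, hb, hM.2.1, hM.1, rfl⟩, fun C' hC' => ?_⟩
    obtain ⟨n', M', -, -, hc', ht', rfl⟩ := mem_goodCodes.1 hC'
    simpa using hM.2.2 n' M' ht' hc'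

theorem minGenCode_spec (T : ObservationTable A τ) : ∃ (n : ℕ) (M : Transducer k m n),
    minGenCode T.inputCode = M.code ∧ M.IsMinimalCompatible T := by
  obtain ⟨n₀, M₀, hM₀⟩ := T.exists_isMinimalCompatible
  have hne : (M₀.truncate (outputBound T.inputCode)).code ∈ minimalCodes T.inputCode :=
    mem_minimalCodes.2 ⟨n₀, _, Transducer.outputsLE_truncate _ (Nat.le_succ _),
      hM₀.truncate T.outputs_le, rfl⟩
  have hmem : minGenCode T.inputCode ∈ minimalCodes T.inputCode := by
    unfold minGenCode
    cases h : minimalCodes T.inputCode with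
    | nil => simp [h] at hne
    | cons C l => simp
  obtain ⟨n, M, -, hM, h⟩ := mem_minimalCodes.1 hmem
  exact ⟨n, M, h.symm, hM⟩

theorem testLength_eq {T : ObservationTable A τ} {M : Transducer k m n}
    (hM : M.IsMinimalCompatible T) : testLength T.inputCode = 2 * (n * n * s) ^ 2 := by
  obtain ⟨n', M', h, hM'⟩ := T.minGenCode_spec
  obtain rfl : n = n' :=
    le_antisymm (hM.2.2 _ M' hM'.1 hM'.2.1) (hM'.2.2 _ M hM.1 hM.2.1)
  have hs : T.inputCode.2.1.2.length = s := by simp [inputCode, dfaCode]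
  rw [testLength, h, hs, Transducer.length_code]

theorem competingCode_mem {T : ObservationTable A τ}
    {t : TransducerCode × TransducerCode × List ℕ} (h : competingCode T.inputCode = some t) :
    ∃ (n : ℕ) (M₁ M₂ : Transducer k m n) (u : List (Fin k)), t = (M₁.code, M₂.code, wordCode u) ∧
      T.IsCompeting M₁ M₂ u ∧ u.length ≤ 2 * (n * n * s) ^ 2 := by
  have ht := List.mem_of_head? h
  obtain ⟨C₁, C₂, x⟩ := t
  simp only [List.mem_filter, List.pair_mem_product, Bool.and_eq_true, Bool.not_eq_true',
    decide_eq_false_iff_not] at ht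
  obtain ⟨⟨hC₁, hC₂, hx⟩, hA, hne⟩ := ht
  obtain ⟨n₁, M₁, -, hM₁, rfl⟩ := mem_minimalCodes.1 hC₁
  obtain ⟨n₂, M₂, -, hM₂, rfl⟩ := mem_minimalCodes.1 hC₂
  obtain rfl : n₁ = n₂ :=
    le_antisymm (hM₁.2.2 _ M₂ hM₂.1 hM₂.2.1) (hM₂.2.2 _ M₁ hM₁.1 hM₁.2.1)
  obtain ⟨u, hu, rfl⟩ := mem_wordsUpTo (k := k).1 hx
  rw [testLength_eq hM₁] at hu
  rw [Transducer.semCode_code, Transducer.semCode_code] at hne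
  exact ⟨n₁, M₁, M₂, u, rfl,
    ⟨hM₁, hM₂, (acceptsCode_dfaCode A u).1 hA, fun e => hne (by rw [e])⟩, hu⟩

/-- The productions are bounded first, keeping the word `v`; only then is the word shortened, for
the new pair. -/
theorem competingCode_ne_none {T : ObservationTable A τ} {n₁ n₂ : ℕ} {M₁ : Transducer k m n₁}
    {M₂ : Transducer k m n₂} {v : List (Fin k)} (h : T.IsCompeting M₁ M₂ v) :
    competingCode T.inputCode ≠ none := by
  obtain ⟨n, N₁, N₂, ⟨h₁, h₂, hv, hne⟩, hb₁, hb₂⟩ :=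
    Transducer.exists_isCompeting_outputsLE h T.outputs_le
  obtain ⟨u, hu, hl, hne⟩ := Transducer.exists_short_difference hv hne
  have hl' : u.length ≤ testLength T.inputCode := by
    rw [testLength_eq h₁]
    -- The linear bound `2 * N` lies below the quadratic one, as `N ≤ N ^ 2` for natural numbers.
    nlinarith [Nat.le_self_pow two_ne_zero (n * n * s)]
  intro hnone
  rw [competingCode, List.head?_eq_none_iff, List.filter_eq_nil_iff] at hnone
  refine hnone (N₁.code, N₂.code, wordCode u) (List.pair_mem_product.2
    ⟨mem_minimalCodes.2 ⟨n, N₁, hb₁, h₁, rfl⟩, List.pair_mem_product.2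
      ⟨mem_minimalCodes.2 ⟨n, N₂, hb₂, h₂, rfl⟩, mem_wordsUpTo.2 ⟨u, hl', rfl⟩⟩⟩) ?_
  have hA : acceptsCode T.inputCode.2.1 (wordCode u) = true := (acceptsCode_dfaCode A u).2 hu
  have hs : (N₁.sem u).map wordCode ≠ (N₂.sem u).map wordCode :=
    fun e => hne (Option.map_injective wordCode_injective e)
  simp [hA, Transducer.semCode_code, hs]

end ObservationTable

theorem mainTheorem3 :
    ∃ (minGen : InputCode → TransducerCode)
      (competingMinGen : InputCode → Option (TransducerCode × TransducerCode × List ℕ)),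
      Computable minGen ∧ Computable competingMinGen ∧
      ∀ (k m s : ℕ) (A : DFA (Fin k) (Fin s)) (τ : List (Fin k) → Option (List (Fin m))),
        (∃ (n : ℕ) (M : Transducer k m n), M.sem = τ) →
        (∀ u, τ u ≠ none → u ∈ A.accepts) →
        ∀ T : ObservationTable A τ,
          (∃ (n : ℕ) (M : Transducer k m n),
            minGen T.inputCode = M.code ∧ M.IsMinimalCompatible T) ∧
          ((∃ (n₁ n₂ : ℕ) (M₁ : Transducer k m n₁) (M₂ : Transducer k m n₂)
              (v : List (Fin k)), T.IsCompeting M₁ M₂ v) →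
            ∃ (n : ℕ) (M₁ M₂ : Transducer k m n) (u : List (Fin k)),
              competingMinGen T.inputCode = some (M₁.code, M₂.code, wordCode u) ∧
              T.IsCompeting M₁ M₂ u ∧ u.length ≤ 2 * (n * n * s) ^ 2) ∧
          ((¬ ∃ (n₁ n₂ : ℕ) (M₁ : Transducer k m n₁) (M₂ : Transducer k m n₂)
              (v : List (Fin k)), T.IsCompeting M₁ M₂ v) →
            competingMinGen T.inputCode = none) := by
  refine ⟨minGenCode, competingCode, primrec_minGenCode.to_comp, primrec_competingCode.to_comp,
    fun k m s A τ _ _ T => ⟨T.minGenCode_spec, ?_, fun hno => ?_⟩⟩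
  · rintro ⟨n₁, n₂, M₁, M₂, v, h⟩
    obtain ⟨t, ht⟩ := Option.ne_none_iff_exists'.1 (ObservationTable.competingCode_ne_none h)
    obtain ⟨n, N₁, N₂, u, rfl, hN, hu⟩ := ObservationTable.competingCode_mem ht
    exact ⟨n, N₁, N₂, u, ht, hN, hu⟩
  · by_contra hne
    obtain ⟨t, ht⟩ := Option.ne_none_iff_exists'.1 hne
    obtain ⟨n, N₁, N₂, u, -, hN, -⟩ := ObservationTable.competingCode_mem ht
    exact hno ⟨n, n, N₁, N₂, u, hN⟩
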